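/- Let $(X_n)_{n\ge 0}$ be an irreducible, positive recurrent Markov chain on a countable (discrete) state space $M$, and write $\mathbb E_x$ for expectation when $X_0=x$. For $y\in M$ let $T(y)=\inf\{n\ge 0: X_n=y\}$. For $A\subset M$ let $T_{\mathrm{cov}}(A)=\sup_{y\in A}T(y)$ and $\mathrm{cov}(A)=\sup_{x\in A}\mathbb E_x T_{\mathrm{cov}}(A)\in[0,\infty]$. Let $d(x,y)=\mathbb E_xT(y)+\mathbb E_yT(x)$ be the commute distance. Put $N_0=1$ and $N_n=2^{2^n}$ for $n\ge1$. An admissible sequence of partitions of a set $A$ is a sequence $(\mathcal A_n)_{n\ge0}$ of partitions of $A$ such that $\mathcal A_{n+1}$ refines $\mathcal A_n$ and $|\mathcal A_n|\le N_n$ for every $n\geq 0$; $A_n(x)$ denotes the cell of $\mathcal A_n$ containing $x$. For $\alpha>0$ and a distance $\rho$ on $A$, with $\Delta(\cdot,\rho)$ denoting the diameter, let $$\gamma_\alpha(A,\rho)=\inf_{(\mathcal A_n)}\ \sup_{x\in A}\ \sum_{n=0}^{\infty}2^{n/\alpha}\,\Delta(A_n(x),\rho)\in[0,\infty],$$ the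 infimum being over all admissible sequences of partitions of $A$. Theorem. There are universal constants $L,C<\infty$ such that, for every such chain which is in addition reversible (i.e. satisfies detailed balance with respect to its invariant probability measure): (i) for every subset $A\subset M$ (in particular for $A=M$), $\ \gamma_1(A,d)\le L\,\mathrm{cov}(A)$; (ii) for every finite $A\subset M$ with $|A|\ge 3$, $$\gamma_1(A,d)\ \le\ \bigl[\gamma_2(A,\sqrt d)\bigr]^2\ \le\ C\,\log(\log|A|)\,\gamma_1(A,d).$$ Thus, when $M$ is finite and $|M|\ge3$, the lower bound $\gamma_1(M,d)/L$ for $\mathrm{cov}(M)$ given by (i) is, up to universal constants, within a factor $\log\log|M|$ of the Ding–Lee–Peres lower bound, which is $[\gamma_2(M,\sqrt d)]^2$ up to a universal constant. -/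

import Mathlib

open MeasureTheory ProbabilityTheory
open scoped ENNReal NNReal

noncomputable section

namespace CoverTime

section Chain

variable {M : Type*} [MeasurableSpace M]

/-- The law `ℙ_x`, on the space `ℕ → M` of trajectories, of the time-homogeneous Markov chain with
transition kernel `κ` started at `x` (Ionescu-Tulcea construction): the conditional law of `ω (n+1)`
given `ω 0, …, ω n` is `κ (ω n)`. -/
def pathLaw (κ : Kernel M M) [IsMarkovKernel κ] (x : M) : Measure (ℕ → M) :=
  Kernel.traj (X := fun _ => M)
    (fun n => κ.comap (fun h : (Π _ : Finset.Iic n, M) => h ⟨n, Finset.mem_Iic.2 le_rfl⟩)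
      (measurable_pi_apply _)) 0 (fun _ => x)

/-- `T(y) = inf {n ≥ 0 : X_n = y}`, with value `⊤` if `y` is never visited. -/
def hitTime (y : M) (ω : ℕ → M) : ℕ∞ := hittingAfter (fun n (ω : ℕ → M) => ω n) {y} 0 ω

/-- `T¹(y) = inf {n ≥ 1 : X_n = y}`. -/
def returnTime (y : M) (ω : ℕ → M) : ℕ∞ := hittingAfter (fun n (ω : ℕ → M) => ω n) {y} 1 ω

/-- `T_cov(A) = sup_{y ∈ A} T(y)`: the first time every point of `A` has been visited. -/
def coverTime (A : Set M) (ω : ℕ → M) : ℕ∞ := ⨆ y ∈ A, hitTime y ω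

/-- `𝔼_x τ` for a time `τ` with values in `ℕ ∪ {∞}`. -/
def expect (κ : Kernel M M) [IsMarkovKernel κ] (x : M) (τ : (ℕ → M) → ℕ∞) : ℝ≥0∞ :=
  ∫⁻ ω, (τ ω : ℝ≥0∞) ∂(pathLaw κ x)

/-- Irreducibility of a chain on a discrete state space: every nonempty set (equivalently, every
point) is reached from every point with positive probability after some number of steps. -/
def IsIrreducibleChain (κ : Kernel M M) : Prop := Kernel.IsIrreducible Measure.count κ

/-- Positive recurrence: the expected return time to each point is finite. -/
def IsPositiveRecurrent (κ : Kernel M M) [IsMarkovKernel κ] : Prop :=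
  ∀ x, expect κ x (returnTime x) < ∞

/-- Reversibility: detailed balance holds for some (necessarily invariant) probability measure. -/
def IsReversibleChain (κ : Kernel M M) : Prop :=
  ∃ π : Measure M, IsProbabilityMeasure π ∧ κ.IsReversible π

/-- `cov(A) = sup_{x ∈ A} 𝔼_x T_cov(A)`. -/
def cov (κ : Kernel M M) [IsMarkovKernel κ] (A : Set M) : ℝ≥0∞ :=
  ⨆ x ∈ A, expect κ x (coverTime A)

/-- The commute distance `d(x, y) = 𝔼_x T(y) + 𝔼_y T(x)`. -/
def commute (κ : Kernel M M) [IsMarkovKernel κ] (x y : M) : ℝ≥0∞ :=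
  expect κ x (hitTime y) + expect κ y (hitTime x)

end Chain

section Chaining

/-- `N_0 = 1` and `N_n = 2 ^ 2 ^ n` for `n ≥ 1`. -/
def admissibleCard (n : ℕ) : ℕ := if n = 0 then 1 else 2 ^ 2 ^ n

/-- An admissible sequence of partitions of `S`, the partitions being given as equivalence relations
(`classes` is the set of cells): `𝒜 (n+1)` refines `𝒜 n`, and `𝒜 n` has at most `N_n` cells. -/
structure IsAdmissible {S : Type*} (𝒜 : ℕ → Setoid S) : Prop where
  refines : ∀ n, 𝒜 (n + 1) ≤ 𝒜 n
  card_le : ∀ n, (𝒜 n).classes.encard ≤ admissibleCard n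

/-- The diameter of `B` for the distance `d`. -/
def diam {S : Type*} (d : S → S → ℝ≥0∞) (B : Set S) : ℝ≥0∞ := ⨆ x ∈ B, ⨆ y ∈ B, d x y

/-- Talagrand's functional
`γ_α(S, d) = inf sup_{x ∈ S} ∑_n 2^{n/α} Δ(A_n(x), d)`, the infimum being over admissible sequences
of partitions of `S`, where `A_n(x)` is the cell of the `n`-th partition containing `x`. -/
def chainingFunctional (α : ℝ) (S : Type*) (d : S → S → ℝ≥0∞) : ℝ≥0∞ :=
  ⨅ (𝒜 : ℕ → Setoid S) (_ : IsAdmissible 𝒜),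
    ⨆ x : S, ∑' n : ℕ, (2 : ℝ≥0∞) ^ ((n : ℝ) / α) * diam d {y | (𝒜 n) y x}

variable {M : Type*} [MeasurableSpace M]

/-- `γ_1(A, d)` for the commute distance `d`. -/
def gammaOne (κ : Kernel M M) [IsMarkovKernel κ] (A : Set M) : ℝ≥0∞ :=
  chainingFunctional 1 A (fun x y => commute κ x y)

/-- `γ_2(A, √d)` for the commute distance `d`. -/
def gammaTwoSqrt (κ : Kernel M M) [IsMarkovKernel κ] (A : Set M) : ℝ≥0∞ :=
  chainingFunctional 2 A (fun x y => commute κ x y ^ (1 / 2 : ℝ))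

end Chaining

end CoverTime

end

/-! Write h(x,y) for the expected hitting time of y from x. Reversibility enters only through the
cyclic identity `hitReal_cyclic`: around a triangle, hitting times add up to the same total in both
directions. Hence h(x,y) - h(y,x) = f(x) - f(y) for some f (`exists_potential`), and 2h(x,y) =
d(x,y) + f(x) - f(y). So points far apart for d at which f is nearly equal are far apart in hitting
time, in both directions.

This gives Talagrand's growth condition for cov (`cov_growth`). Take 2^(2^n) points with mutual
distances at least a, each with a cluster of radius a/16 around it. If f varies by a·2^n on the
points, a single hitting time is already of that order. Otherwise, by pigeonhole, more than
2^(2^(n-1)) of the points have f constant up to a/4, and Matthews' argument applied to their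
clusters (`matthews_le_expect_clusterTime`) shows that visiting all of them costs at least a
constant times a·log(2^(2^(n-1))), which is of order a·2^n. When the last cluster is reached, none
of it has been visited, so covering it costs about its own cov on top (`expect_clusterTime_add_le`).

Part (i) is then the generic partitioning scheme for functionals with the growth condition
(`exists_admissible`): a greedy splitting in which either the radius shrinks or the functional drops
on small balls, with a potential function paying for the sum of 2^n times the diameters.

Part (ii) is deterministic. One inequality is ∑ u² ≤ (∑ u)². For the other, only the first k scales
matter, where 2^(2^k) ≥ |A|, because beyond them the partition into points is admissible;
Cauchy–Schwarz over these scales loses the factor k, of order log log |A|. -/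

noncomputable section

namespace CoverTime

/-! ### The Markov property of the path law -/

section Markov

variable {M : Type*} [MeasurableSpace M]

/-- The time-`n` transition kernel, reading only the last point of the history. -/
def stepKernel (κ : Kernel M M) (n : ℕ) : Kernel (Π _ : Finset.Iic n, M) M :=
  κ.comap (fun h : (Π _ : Finset.Iic n, M) => h ⟨n, Finset.mem_Iic.2 le_rfl⟩)
    (measurable_pi_apply _)

instance (κ : Kernel M M) [IsMarkovKernel κ] (n : ℕ) : IsMarkovKernel (stepKernel κ n) := by
  unfold stepKernel; infer_instance

variable (κ : Kernel M M) [IsMarkovKernel κ]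

/-- The law of the trajectory given the history `u` up to time `n`. -/
def historyLaw (n : ℕ) : Kernel (Π _ : Finset.Iic n, M) (ℕ → M) :=
  Kernel.traj (X := fun _ => M) (stepKernel κ) n

instance (n : ℕ) : IsMarkovKernel (historyLaw κ n) := by
  unfold historyLaw; infer_instance

theorem pathLaw_eq_historyLaw (x : M) : pathLaw κ x = historyLaw κ 0 (fun _ => x) := rfl

instance (x : M) : IsProbabilityMeasure (pathLaw κ x) := by
  rw [pathLaw_eq_historyLaw]; infer_instance

/-- The cylinder of trajectories agreeing with `c` up to time `m`. -/
def cyl (c : ℕ → M) (m : ℕ) : Set (ℕ → M) := {ω | ∀ i ≤ m, ω i = c i}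

/-- The shift of trajectories by `n` steps. -/
def shift (n : ℕ) (ω : ℕ → M) : ℕ → M := fun k => ω (n + k)

theorem measurable_shift (n : ℕ) : Measurable (shift (M := M) n) :=
  measurable_pi_lambda _ fun k => measurable_pi_apply (n + k)

/-- On `B` the last coordinate of the history is always `z`, so the conditional law of the next
point is the constant `κ z` and factors out. -/
theorem historyLaw_step {a b : ℕ} (hab : a ≤ b) (u : Π _ : Finset.Iic a, M)
    {B : Set (Π _ : Finset.Iic b, M)} (hB : MeasurableSet B) {Y : Set M} (hY : MeasurableSet Y)
    {z : M} (hz : ∀ β ∈ B, β ⟨b, Finset.mem_Iic.2 le_rfl⟩ = z) :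
    historyLaw κ a u {ω | Preorder.frestrictLe b ω ∈ B ∧ ω (b + 1) ∈ Y} =
      historyLaw κ a u {ω | Preorder.frestrictLe b ω ∈ B} * κ z Y := by
  have h := Kernel.partialTraj_compProd_eq_map_traj (X := fun _ => M) (κ := stepKernel κ) hab
    (x₀ := u)
  have h1 := congrArg (fun μ => μ (B ×ˢ Y)) h
  rw [Measure.map_apply (by fun_prop) (hB.prod hY), Measure.compProd_apply_prod hB hY,
    setLIntegral_congr_fun (g := fun _ => κ z Y) hB, setLIntegral_const] at h1
  · have h2 : historyLaw κ a u {ω | Preorder.frestrictLe b ω ∈ B} =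
        Kernel.partialTraj (X := fun _ => M) (stepKernel κ) a b u B := by
      rw [← Kernel.traj_map_frestrictLe, Kernel.map_apply' _ (by fun_prop) _ hB]
      rfl
    rw [h2, mul_comm, h1]
    rfl
  · intro β hβ
    simp only [stepKernel, Kernel.comap_apply, hz β hβ]

theorem pathLaw_map_one (x : M) : (pathLaw κ x).map (fun ω => ω 1) = κ x := by
  have h := Kernel.map_traj_succ_self (X := fun _ => M) (κ := stepKernel κ) (a := 0)
  have h1 := congrArg (fun η => η (fun _ => x)) h
  rw [Kernel.map_apply _ (by fun_prop)] at h1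
  exact h1

theorem expect_mono {σ τ : (ℕ → M) → ℕ∞} (h : ∀ ω, σ ω ≤ τ ω) (x : M) :
    expect κ x σ ≤ expect κ x τ :=
  lintegral_mono fun ω => ENat.toENNReal_le.2 (h ω)

variable [Countable M] [DiscreteMeasurableSpace M]

theorem ext_of_cyl {μ ν : Measure (ℕ → M)} [IsProbabilityMeasure μ] [IsProbabilityMeasure ν]
    (h : ∀ c m, μ (cyl c m) = ν (cyl c m)) : μ = ν := by
  have hm : ∀ m, μ.map (Preorder.frestrictLe (π := fun _ => M) m) =
      ν.map (Preorder.frestrictLe m) := by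
    intro m
    refine Measure.ext_of_singleton fun β => ?_
    rw [Measure.map_apply (by fun_prop) (measurableSet_singleton _),
      Measure.map_apply (by fun_prop) (measurableSet_singleton _)]
    have : Preorder.frestrictLe (π := fun _ => M) m ⁻¹' {β} =
        cyl (fun i => β ⟨min i m, Finset.mem_Iic.2 (min_le_right _ _)⟩) m := by
      ext ω
      simp only [Set.mem_preimage, Set.mem_singleton_iff, cyl, Set.mem_ofPred_eq]
      constructor
      · rintro rfl i hi
        simp [Preorder.frestrictLe, min_eq_left hi]
      · intro hω
        ext ⟨i, hi⟩
        have hi' := Finset.mem_Iic.1 hi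
        simp [Preorder.frestrictLe, hω i hi', min_eq_left hi']
    rw [this, h]
  have hν : IsProjectiveLimit ν (fun I => ν.map I.restrict) := fun I => rfl
  refine IsProjectiveLimit.unique (P := fun I => ν.map I.restrict) ?_ hν
  intro I
  have hI : I ⊆ Finset.Iic (I.sup id) := fun i hi => Finset.mem_Iic.2 (Finset.le_sup (f := id) hi)
  have h2 := congrArg (fun ρ => ρ.map (Finset.restrict₂ (π := fun _ => M) hI)) (hm (I.sup id))
  simp only at h2
  rw [Measure.map_map (by fun_prop) (by fun_prop), Measure.map_map (by fun_prop) (by fun_prop)]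
    at h2
  exact h2

theorem measurableSet_cyl (c : ℕ → M) (m : ℕ) : MeasurableSet (cyl c m) := by
  have : cyl c m = ⋂ i, ⋂ (_ : i ≤ m), (fun ω : ℕ → M => ω i) ⁻¹' {c i} := by
    ext ω; simp [cyl]
  rw [this]
  exact MeasurableSet.iInter fun i => MeasurableSet.iInter fun _ =>
    measurable_pi_apply i (measurableSet_singleton _)

theorem historyLaw_history (n : ℕ) (u : Π _ : Finset.Iic n, M) :
    ∀ᵐ ω ∂(historyLaw κ n u), Preorder.frestrictLe n ω = u := by
  have h := Kernel.traj_map_frestrictLe_apply (X := fun _ => M) (κ := stepKernel κ) n n u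
  rw [Kernel.partialTraj_self, Kernel.id_apply] at h
  have h1 : ∀ᵐ v ∂((historyLaw κ n u).map (Preorder.frestrictLe (π := fun _ => M) n)), v = u := by
    change ∀ᵐ v ∂((Kernel.traj (X := fun _ => M) (stepKernel κ) n u).map _), v = u
    rw [h]
    exact (ae_dirac_iff (measurableSet_singleton u)).2 rfl
  exact ae_of_ae_map (by fun_prop) h1

theorem historyLaw_shift_cyl_succ (n : ℕ) (u : Π _ : Finset.Iic n, M) (c : ℕ → M) (m : ℕ) :
    (historyLaw κ n u).map (shift n) (cyl c (m + 1)) =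
      (historyLaw κ n u).map (shift n) (cyl c m) * κ (c m) {c (m + 1)} := by
  rw [Measure.map_apply (measurable_shift n) (measurableSet_cyl c _),
    Measure.map_apply (measurable_shift n) (measurableSet_cyl c _)]
  have key := historyLaw_step κ (Nat.le_add_right n m) u
    (B := {β | ∀ i (hi : i ≤ m), β ⟨n + i, Finset.mem_Iic.2 (by omega)⟩ = c i})
    (Set.to_countable _).measurableSet (measurableSet_singleton (c (m + 1))) (z := c m)
    (fun β hβ => hβ m le_rfl)
  have e : shift n ⁻¹' cyl c m = {ω : ℕ → M | Preorder.frestrictLe (π := fun _ => M) (n + m) ω ∈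
      {β : Π _ : Finset.Iic (n + m), M |
        ∀ i (hi : i ≤ m), β ⟨n + i, Finset.mem_Iic.2 (by omega)⟩ = c i}} := rfl
  rw [e]
  convert key using 2
  · ext ω
    simp only [cyl, shift, Set.mem_preimage, Set.mem_ofPred_eq, Preorder.frestrictLe,
      Set.mem_singleton_iff, Finset.restrict]
    constructor
    · intro h
      exact ⟨fun i hi => h i (by omega), h (m + 1) le_rfl⟩
    · rintro ⟨h1, h2⟩ i hi
      rcases Nat.lt_or_ge m i with h | h
      · obtain rfl : i = m + 1 := by omega
        exact h2
      · exact h1 i h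

theorem historyLaw_shift_cyl_zero (n : ℕ) (u : Π _ : Finset.Iic n, M) (c : ℕ → M) :
    (historyLaw κ n u).map (shift n) (cyl c 0) =
      ({c | c 0 = u ⟨n, Finset.mem_Iic.2 le_rfl⟩} : Set (ℕ → M)).indicator 1 c := by
  rw [Measure.map_apply (measurable_shift n) (measurableSet_cyl c _)]
  have h := historyLaw_history κ n u
  by_cases hc : c 0 = u ⟨n, Finset.mem_Iic.2 le_rfl⟩
  · rw [Set.indicator_of_mem (by exact hc)]
    refine (prob_compl_eq_zero_iff (measurable_shift n (measurableSet_cyl c 0))).1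
      (mem_ae_iff.1 ?_)
    filter_upwards [h] with ω hω
    intro i hi
    obtain rfl : i = 0 := by omega
    rw [hc, ← hω]
    rfl
  · rw [Set.indicator_of_notMem (by exact hc)]
    refine measure_mono_null ?_ (ae_iff.1 h)
    intro ω hω hh
    have := hω 0 le_rfl
    exact hc (by rw [← this, ← hh]; rfl)

/-- Time homogeneity. Both laws charge a cylinder of length 0 in the same way, and lengthening the
cylinder by one step multiplies both by the same transition probability; cylinders determine the
law. -/
theorem historyLaw_map_shift (n : ℕ) (u : Π _ : Finset.Iic n, M) :
    (historyLaw κ n u).map (shift n) = pathLaw κ (u ⟨n, Finset.mem_Iic.2 le_rfl⟩) := by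
  have h0 : pathLaw κ (u ⟨n, Finset.mem_Iic.2 le_rfl⟩) =
      (historyLaw κ 0 (fun _ => u ⟨n, Finset.mem_Iic.2 le_rfl⟩)).map (shift 0) := by
    have : shift (M := M) 0 = id := by
      ext ω k; simp [shift]
    rw [this, Measure.map_id, pathLaw_eq_historyLaw]
  rw [h0]
  have := Measure.isProbabilityMeasure_map (μ := historyLaw κ n u)
    (measurable_shift n).aemeasurable
  have := Measure.isProbabilityMeasure_map
    (μ := historyLaw κ 0 (fun _ => u ⟨n, Finset.mem_Iic.2 le_rfl⟩))
    (measurable_shift 0).aemeasurable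
  refine ext_of_cyl fun c m => ?_
  induction m with
  | zero => rw [historyLaw_shift_cyl_zero, historyLaw_shift_cyl_zero]
  | succ m ih => rw [historyLaw_shift_cyl_succ, historyLaw_shift_cyl_succ, ih]

theorem pathLaw_start (x : M) : ∀ᵐ ω ∂(pathLaw κ x), ω 0 = x := by
  filter_upwards [historyLaw_history κ 0 (fun _ => x)] with ω hω
  exact congrFun hω ⟨0, Finset.mem_Iic.2 le_rfl⟩

/-- The **Markov property** at time `n`, for an event depending on the trajectory up to time `n`. -/
theorem setLIntegral_shift (x : M) (n : ℕ) (B : Set (Π _ : Finset.Iic n, M))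
    {Φ : (ℕ → M) → ℝ≥0∞} (hΦ : Measurable Φ) :
    ∫⁻ ω in Preorder.frestrictLe n ⁻¹' B, Φ (shift n ω) ∂(pathLaw κ x) =
      ∫⁻ ω in Preorder.frestrictLe n ⁻¹' B, (∫⁻ ω', Φ ω' ∂(pathLaw κ (ω n))) ∂(pathLaw κ x) := by
  have hB : MeasurableSet B := (Set.to_countable _).measurableSet
  -- The path law is disintegrated over the history up to time `n`; given the history, the shifted
  -- path is a fresh chain by `historyLaw_map_shift`.
  have hu := Kernel.partialTraj_compProd_traj (X := fun _ => M) (κ := stepKernel κ)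
    (Nat.zero_le n) (fun _ => x)
  have hΨ : Measurable fun p : (Π _ : Finset.Iic n, M) × (ℕ → M) =>
      (B ×ˢ Set.univ).indicator (fun p => Φ (shift n p.2)) p :=
    (hΦ.comp ((measurable_shift n).comp measurable_snd)).indicator (hB.prod MeasurableSet.univ)
  have h1 := congrArg (fun μ => ∫⁻ p, (B ×ˢ Set.univ).indicator (fun p => Φ (shift n p.2)) p ∂μ) hu
  rw [lintegral_map hΨ (by fun_prop), Measure.lintegral_compProd hΨ] at h1
  have hpre : MeasurableSet (Preorder.frestrictLe (π := fun _ => M) n ⁻¹' B) :=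
    (Preorder.measurable_frestrictLe n) hB
  rw [← lintegral_indicator hpre, ← lintegral_indicator hpre]
  have hl : ∫⁻ ω, (Preorder.frestrictLe (π := fun _ => M) n ⁻¹' B).indicator
        (fun ω => Φ (shift n ω)) ω ∂(pathLaw κ x) =
      ∫⁻ ω, (B ×ˢ Set.univ).indicator (fun p => Φ (shift n p.2))
        (Preorder.frestrictLe (π := fun _ => M) n ω, ω) ∂(pathLaw κ x) := by
    refine lintegral_congr fun ω => ?_
    by_cases hω : Preorder.frestrictLe (π := fun _ => M) n ω ∈ B
    · rw [Set.indicator_of_mem (by exact hω), Set.indicator_of_mem (by exact ⟨hω, trivial⟩)]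
    · rw [Set.indicator_of_notMem (by exact hω), Set.indicator_of_notMem (by exact fun h => hω h.1)]
  rw [hl]
  refine h1.symm.trans ?_
  have h2 : ∀ β : Π _ : Finset.Iic n, M,
      ∫⁻ ω, (B ×ˢ Set.univ).indicator (fun p => Φ (shift n p.2)) (β, ω)
        ∂(Kernel.traj (X := fun _ => M) (stepKernel κ) n β) =
      B.indicator (fun β => ∫⁻ ω', Φ ω' ∂(pathLaw κ (β ⟨n, Finset.mem_Iic.2 le_rfl⟩))) β := by
    intro β
    by_cases hβ : β ∈ B
    · rw [Set.indicator_of_mem hβ, ← historyLaw_map_shift, lintegral_map hΦ (measurable_shift n)]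
      refine lintegral_congr fun ω => ?_
      rw [Set.indicator_of_mem (by exact ⟨hβ, trivial⟩)]
    · rw [Set.indicator_of_notMem hβ]
      refine (lintegral_congr fun ω => ?_).trans lintegral_zero
      rw [Set.indicator_of_notMem (by exact fun h => hβ h.1)]
  rw [lintegral_congr h2, ← Kernel.traj_map_frestrictLe_apply,
    lintegral_map (measurable_of_countable _) (by fun_prop)]
  rfl

end Markov

/-! ### Events determined by time n, and the strong Markov property -/

section Stopping

variable {M : Type*}

/-- The event `D` depends on the trajectory only up to time `n`. -/
def IsDetermined (n : ℕ) (D : Set (ℕ → M)) : Prop :=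
  ∀ ω ω' : ℕ → M, (∀ i ≤ n, ω i = ω' i) → ω ∈ D → ω' ∈ D

theorem IsDetermined.preimage_image {n : ℕ} {D : Set (ℕ → M)} (hD : IsDetermined n D) :
    Preorder.frestrictLe (π := fun _ => M) n ⁻¹' (Preorder.frestrictLe n '' D) = D := by
  refine Set.Subset.antisymm ?_ (Set.subset_preimage_image _ _)
  rintro ω ⟨ω', h, e⟩
  exact hD ω' ω (fun i hi => congrFun e ⟨i, Finset.mem_Iic.2 hi⟩) h

theorem isDetermined_compl {n : ℕ} {D : Set (ℕ → M)} (hD : IsDetermined n D) :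
    IsDetermined n Dᶜ :=
  fun ω ω' h hω hω' => hω (hD ω' ω (fun i hi => (h i hi).symm) hω')

theorem IsDetermined.inter {n : ℕ} {D E : Set (ℕ → M)} (hD : IsDetermined n D)
    (hE : IsDetermined n E) : IsDetermined n (D ∩ E) :=
  fun ω ω' h hω => ⟨hD ω ω' h hω.1, hE ω ω' h hω.2⟩

theorem isDetermined_univ (n : ℕ) : IsDetermined n (Set.univ : Set (ℕ → M)) :=
  fun _ _ _ _ => trivial

variable [MeasurableSpace M] [Countable M] [DiscreteMeasurableSpace M]

theorem IsDetermined.measurableSet {n : ℕ} {D : Set (ℕ → M)} (hD : IsDetermined n D) :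
    MeasurableSet D := by
  rw [← hD.preimage_image]
  exact (Preorder.measurable_frestrictLe n) (Set.to_countable _).measurableSet

variable (κ : Kernel M M) [IsMarkovKernel κ]

theorem IsDetermined.setLIntegral_shift {n : ℕ} {D : Set (ℕ → M)} (hD : IsDetermined n D) (x : M)
    {Φ : (ℕ → M) → ℝ≥0∞} (hΦ : Measurable Φ) :
    ∫⁻ ω in D, Φ (shift n ω) ∂(pathLaw κ x) =
      ∫⁻ ω in D, (∫⁻ ω', Φ ω' ∂(pathLaw κ (ω n))) ∂(pathLaw κ x) := by
  have := CoverTime.setLIntegral_shift κ x n (Preorder.frestrictLe n '' D) hΦ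
  rwa [hD.preimage_image] at this

theorem lintegral_shift_one (x : M) {Φ : (ℕ → M) → ℝ≥0∞} (hΦ : Measurable Φ) :
    ∫⁻ ω, Φ (shift 1 ω) ∂(pathLaw κ x) = ∫⁻ y, (∫⁻ ω', Φ ω' ∂(pathLaw κ y)) ∂(κ x) := by
  have h := (isDetermined_univ (M := M) 1).setLIntegral_shift κ x hΦ
  rw [setLIntegral_univ, setLIntegral_univ] at h
  rw [h, ← pathLaw_map_one κ x, lintegral_map (measurable_of_countable _) (measurable_pi_apply 1)]

variable {κ} in
/-- Lower bound by the strong Markov property: past the stopping time `σ`, on the event `E`, the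
quantity `Ψ` still exceeds a functional of the future whose expectation is at least `b`. -/
theorem le_lintegral_of_stopping {x : M} {σ : (ℕ → M) → ℕ∞} {E : Set (ℕ → M)}
    {Φ Ψ : (ℕ → M) → ℝ≥0∞} {b : ℝ≥0∞} (hσ : Measurable σ)
    (hE : ∀ n : ℕ, IsDetermined n {ω | ω ∈ E ∧ σ ω = n}) (hΦ : Measurable Φ)
    (hΨσ : ∀ ω, (σ ω : ℝ≥0∞) ≤ Ψ ω)
    (hΨ : ∀ (n : ℕ) ω, ω ∈ E → σ ω = n → n + Φ (shift n ω) ≤ Ψ ω)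
    (hb : ∀ (n : ℕ) ω, ω 0 = x → ω ∈ E → σ ω = n → b ≤ ∫⁻ ω', Φ ω' ∂(pathLaw κ (ω n))) :
    expect κ x σ + b * pathLaw κ x {ω | ω ∈ E ∧ σ ω ≠ ⊤} ≤ ∫⁻ ω, Ψ ω ∂(pathLaw κ x) := by
  set D : ℕ → Set (ℕ → M) := fun n => {ω | ω ∈ E ∧ σ ω = n} with hDdef
  have hDm : ∀ n, MeasurableSet (D n) := fun n => (hE n).measurableSet
  have hdisj : Pairwise (Function.onFun Disjoint D) := by
    intro m n hmn
    refine Set.disjoint_left.2 fun ω h1 h2 => hmn ?_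
    exact_mod_cast h1.2.symm.trans h2.2
  have hU : {ω | ω ∈ E ∧ σ ω ≠ ⊤} = ⋃ n, D n := by
    ext ω
    simp only [hDdef, Set.mem_ofPred_eq, Set.mem_iUnion]
    constructor
    · rintro ⟨h1, h2⟩
      obtain ⟨n, hn⟩ := ENat.ne_top_iff_exists.1 h2
      exact ⟨n, h1, hn.symm⟩
    · rintro ⟨n, h1, h2⟩
      exact ⟨h1, by rw [h2]; exact ENat.natCast_ne_top n⟩
  have hpt : ∀ ω, (σ ω : ℝ≥0∞) + ∑' n, (D n).indicator (fun ω => Φ (shift n ω)) ω ≤ Ψ ω := by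
    intro ω
    by_cases h : ∃ n, ω ∈ D n
    · obtain ⟨n, hn⟩ := h
      rw [tsum_eq_single n, Set.indicator_of_mem hn]
      · refine le_trans (le_of_eq ?_) (hΨ n ω hn.1 hn.2)
        rw [hn.2]; simp
      · intro m hm
        refine Set.indicator_of_notMem (fun h => hm ?_) _
        exact_mod_cast h.2.symm.trans hn.2
    · push Not at h
      simp only [Set.indicator_of_notMem (h _), tsum_zero, add_zero]
      exact hΨσ ω
  have hσ' : Measurable fun ω => (σ ω : ℝ≥0∞) := (measurable_of_countable _).comp hσ
  refine le_trans ?_ (lintegral_mono hpt)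
  rw [lintegral_add_left hσ', lintegral_tsum]
  · rw [hU, measure_iUnion hdisj hDm, ← ENNReal.tsum_mul_left]
    refine add_le_add le_rfl (ENNReal.tsum_le_tsum fun n => ?_)
    rw [lintegral_indicator (hDm n), (hE n).setLIntegral_shift κ x hΦ, ← setLIntegral_const]
    refine lintegral_mono_ae ?_
    filter_upwards [ae_restrict_mem (hDm n), ae_restrict_of_ae (pathLaw_start κ x)] with ω h1 h2
    exact hb n ω h2 h1.1 h1.2
  · intro n
    exact ((hΦ.comp (measurable_shift n)).indicator (hDm n)).aemeasurable

variable {κ} in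
/-- Upper bound by the strong Markov property. -/
theorem lintegral_le_of_stopping {x : M} {σ : (ℕ → M) → ℕ∞}
    {Φ Ψ : (ℕ → M) → ℝ≥0∞} {b : ℝ≥0∞} (hσ : Measurable σ)
    (hE : ∀ n : ℕ, IsDetermined n {ω | σ ω = n}) (hΦ : Measurable Φ)
    (hΨ : ∀ (n : ℕ) ω, σ ω = n → Ψ ω ≤ n + Φ (shift n ω))
    (hb : ∀ (n : ℕ) ω, σ ω = n → ∫⁻ ω', Φ ω' ∂(pathLaw κ (ω n)) ≤ b) :
    ∫⁻ ω, Ψ ω ∂(pathLaw κ x) ≤ expect κ x σ + b := by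
  set D : ℕ → Set (ℕ → M) := fun n => {ω | σ ω = n} with hDdef
  have hDm : ∀ n, MeasurableSet (D n) := fun n => (hE n).measurableSet
  have hdisj : Pairwise (Function.onFun Disjoint D) := by
    intro m n hmn
    refine Set.disjoint_left.2 fun ω h1 h2 => hmn ?_
    exact_mod_cast (show σ ω = m from h1).symm.trans h2
  have hpt : ∀ ω, Ψ ω ≤ (σ ω : ℝ≥0∞) + ∑' n, (D n).indicator (fun ω => Φ (shift n ω)) ω := by
    intro ω
    by_cases h : σ ω = ⊤
    · simp [h]
    · obtain ⟨n, hn⟩ := ENat.ne_top_iff_exists.1 h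
      have hn' : ω ∈ D n := hn.symm
      rw [tsum_eq_single n, Set.indicator_of_mem hn']
      · refine (hΨ n ω hn.symm).trans (le_of_eq ?_)
        rw [← hn]; simp
      · intro m hm
        refine Set.indicator_of_notMem (fun h => hm ?_) _
        exact_mod_cast (show σ ω = m from h).symm.trans hn.symm
  have hσ' : Measurable fun ω => (σ ω : ℝ≥0∞) := (measurable_of_countable _).comp hσ
  refine (lintegral_mono hpt).trans ?_
  rw [lintegral_add_left hσ', lintegral_tsum]
  · refine add_le_add le_rfl ?_
    calc _ ≤ ∑' n, b * pathLaw κ x (D n) := by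
          refine ENNReal.tsum_le_tsum fun n => ?_
          rw [lintegral_indicator (hDm n), (hE n).setLIntegral_shift κ x hΦ, ← setLIntegral_const]
          refine lintegral_mono_ae ?_
          filter_upwards [ae_restrict_mem (hDm n)] with ω h1
          exact hb n ω h1
      _ = b * pathLaw κ x (⋃ n, D n) := by
          rw [ENNReal.tsum_mul_left, measure_iUnion hdisj hDm]
      _ ≤ b := mul_le_of_le_one_right' prob_le_one
  · intro n
    exact ((hΦ.comp (measurable_shift n)).indicator (hDm n)).aemeasurable

end Stopping

/-! ### Hitting and cover times, and one-step equations -/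

section Hitting

variable {M : Type*}

/-- The first time at which the trajectory is in `H`. -/
def hitSet (H : Set M) (ω : ℕ → M) : ℕ∞ := hittingAfter (fun n (ω : ℕ → M) => ω n) H 0 ω

theorem hitTime_eq_hitSet (y : M) (ω : ℕ → M) : hitTime y ω = hitSet {y} ω := rfl

theorem hitSet_le_iff {H : Set M} {ω : ℕ → M} {n : ℕ} : hitSet H ω ≤ n ↔ ∃ j ≤ n, ω j ∈ H := by
  have := hittingAfter_le_iff (u := fun n (ω : ℕ → M) => ω n) (s := H) (n := 0) (i := n) (ω := ω)
  unfold hitSet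
  refine this.trans ?_
  simp

theorem lt_hitSet_iff {H : Set M} {ω : ℕ → M} {n : ℕ} :
    (n : ℕ∞) < hitSet H ω ↔ ∀ j ≤ n, ω j ∉ H := by
  rw [← not_le, hitSet_le_iff]; push Not; rfl

theorem le_hitSet_iff {H : Set M} {ω : ℕ → M} {n : ℕ} :
    (n : ℕ∞) ≤ hitSet H ω ↔ ∀ j < n, ω j ∉ H := by
  cases n with
  | zero => simp
  | succ n =>
    rw [Nat.cast_succ, ENat.add_one_le_iff (ENat.natCast_ne_top n), lt_hitSet_iff]
    simp only [Nat.lt_succ_iff]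

theorem hitSet_eq_coe_iff {H : Set M} {ω : ℕ → M} {n : ℕ} :
    hitSet H ω = n ↔ ω n ∈ H ∧ ∀ j < n, ω j ∉ H := by
  rw [le_antisymm_iff, hitSet_le_iff, le_hitSet_iff]
  constructor
  · rintro ⟨⟨j, hj, h1⟩, h2⟩
    obtain rfl : j = n := by
      by_contra hne
      exact h2 j (lt_of_le_of_ne hj hne) h1
    exact ⟨h1, h2⟩
  · rintro ⟨h1, h2⟩
    exact ⟨⟨n, le_rfl, h1⟩, h2⟩

theorem hitSet_anti {H K : Set M} (h : H ⊆ K) (ω : ℕ → M) : hitSet K ω ≤ hitSet H ω := by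
  refine ENat.forall_natCast_le_iff_le.1 fun n hn => ?_
  rw [le_hitSet_iff] at hn ⊢
  exact fun j hj hK => hn j hj (h hK)

theorem hitSet_shift {H : Set M} {ω : ℕ → M} {n : ℕ} (h : ∀ j < n, ω j ∉ H) :
    hitSet H ω = n + hitSet H (shift n ω) := by
  refine ENat.eq_of_forall_natCast_le_iff fun m => ?_
  rw [le_hitSet_iff]
  rcases le_total m n with hmn | hmn
  · refine iff_of_true (fun j hj => h j (hj.trans_le hmn)) ?_
    exact le_add_right (by exact_mod_cast hmn)
  · obtain ⟨k, rfl⟩ := Nat.exists_eq_add_of_le hmn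
    rw [Nat.cast_add, ENat.add_le_add_iff_left (ENat.natCast_ne_top n), le_hitSet_iff]
    constructor
    · intro h1 j hj
      exact h1 (n + j) (by omega)
    · intro h1 j hj
      rcases Nat.lt_or_ge j n with h2 | h2
      · exact h j h2
      · obtain ⟨i, rfl⟩ := Nat.exists_eq_add_of_le h2
        exact h1 i (by omega)

theorem hitSet_le_shift (H : Set M) (ω : ℕ → M) (n : ℕ) :
    hitSet H ω ≤ n + hitSet H (shift n ω) := by
  by_cases h : ∀ j < n, ω j ∉ H
  · exact (hitSet_shift h).le
  · push Not at h
    obtain ⟨j, hj, h1⟩ := h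
    refine le_trans (hitSet_le_iff.2 ⟨j, hj.le, h1⟩) (le_add_right le_rfl)

theorem coverTime_le_shift (A : Set M) (ω : ℕ → M) (n : ℕ) :
    coverTime A ω ≤ n + coverTime A (shift n ω) := by
  refine iSup₂_le fun y hy => (hitSet_le_shift {y} ω n).trans ?_
  exact add_le_add le_rfl (le_iSup₂ (f := fun y (_ : y ∈ A) => hitTime y (shift n ω)) y hy)

theorem hitTime_le_coverTime {A : Set M} {y : M} (hy : y ∈ A) (ω : ℕ → M) :
    hitTime y ω ≤ coverTime A ω :=
  le_iSup₂ (f := fun y (_ : y ∈ A) => hitTime y ω) y hy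

theorem coverTime_mono {A B : Set M} (h : A ⊆ B) (ω : ℕ → M) : coverTime A ω ≤ coverTime B ω :=
  iSup₂_le fun _ hy => hitTime_le_coverTime (h hy) ω

theorem hitSet_le_coverTime {A : Set M} (hA : A.Nonempty) (ω : ℕ → M) :
    hitSet A ω ≤ coverTime A ω := by
  obtain ⟨y, hy⟩ := hA
  exact (hitSet_anti (Set.singleton_subset_iff.2 hy) ω).trans (hitTime_le_coverTime hy ω)

/-- Before time `n` nothing of `A` is seen, so every hitting time in the supremum restarts at `n`.
Nonemptiness matters: an empty supremum is 0. -/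
theorem coverTime_shift {A : Set M} (hA : A.Nonempty) {ω : ℕ → M} {n : ℕ}
    (h : ∀ j < n, ω j ∉ A) : n + coverTime A (shift n ω) ≤ coverTime A ω := by
  obtain ⟨y, hy⟩ := hA
  have : Nonempty A := ⟨⟨y, hy⟩⟩
  unfold coverTime
  rw [iSup_subtype', iSup_subtype', ENat.add_iSup]
  refine iSup_mono fun z => ?_
  rw [hitTime_eq_hitSet, hitTime_eq_hitSet, hitSet_shift (H := {z.1}) (n := n) (ω := ω)]
  intro j hj he
  exact h j hj (by rw [Set.mem_singleton_iff.1 he]; exact z.2)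

theorem coverTime_singleton (y : M) : coverTime {y} = hitTime y := by
  ext1 ω; simp [coverTime]

theorem returnTime_eq (y : M) (ω : ℕ → M) : returnTime y ω = 1 + hitTime y (shift 1 ω) := by
  refine ENat.eq_of_forall_natCast_le_iff fun m => ?_
  have h1 : ∀ m : ℕ, (m : ℕ∞) ≤ returnTime y ω ↔ ∀ j < m, 1 ≤ j → ω j ≠ y := by
    intro m
    cases m with
    | zero => simp
    | succ m =>
      rw [Nat.cast_succ, ENat.add_one_le_iff (ENat.natCast_ne_top m), ← not_le]
      have := hittingAfter_le_iff (u := fun n (ω : ℕ → M) => ω n) (s := {y}) (n := 1) (i := m)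
        (ω := ω)
      unfold returnTime
      refine (not_congr this).trans ?_
      simp only [Set.mem_Icc, Set.mem_singleton_iff, not_exists, not_and, and_imp]
      exact ⟨fun h j h1 h2 => h j h2 (by omega), fun h j h1 h2 => h j (by omega) h1⟩
  rw [h1]
  cases m with
  | zero => simp
  | succ m =>
    rw [Nat.cast_succ, add_comm (m : ℕ∞), ENat.add_le_add_iff_left (by simp),
      hitTime_eq_hitSet, le_hitSet_iff]
    constructor
    · intro h j hj
      exact h (1 + j) (by omega) (by omega)
    · intro h j hj h1
      obtain ⟨i, rfl⟩ := Nat.exists_eq_add_of_le h1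
      exact h i (by omega)

theorem isDetermined_hitSet_le (H : Set M) (n : ℕ) : IsDetermined n {ω | hitSet H ω ≤ n} := by
  intro ω ω' h hω
  obtain ⟨j, hj, h1⟩ := hitSet_le_iff.1 hω
  exact hitSet_le_iff.2 ⟨j, hj, by rwa [← h j hj]⟩

/-- Being at most `n` is determined by time `n`. -/
def IsStopping (σ : (ℕ → M) → ℕ∞) : Prop := ∀ n : ℕ, IsDetermined n {ω | σ ω ≤ n}

theorem IsDetermined.mono {m n : ℕ} (hmn : m ≤ n) {D : Set (ℕ → M)} (hD : IsDetermined m D) :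
    IsDetermined n D := fun ω ω' h => hD ω ω' fun i hi => h i (hi.trans hmn)

theorem IsStopping.eq {σ : (ℕ → M) → ℕ∞} (hσ : IsStopping σ) (n : ℕ) :
    IsDetermined n {ω | σ ω = n} := by
  cases n with
  | zero => simpa using hσ 0
  | succ n =>
    have : {ω | σ ω = (n + 1 : ℕ)} = {ω | σ ω ≤ (n + 1 : ℕ)} ∩ {ω | σ ω ≤ n}ᶜ := by
      ext ω
      simp only [Set.mem_ofPred_eq, Set.mem_inter_iff, Set.mem_compl_iff, not_le]
      rw [Nat.cast_succ, ← ENat.add_one_le_iff (ENat.natCast_ne_top n)]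
      exact le_antisymm_iff
    rw [this]
    exact (hσ _).inter (isDetermined_compl ((hσ n).mono (Nat.le_succ n)))

theorem isStopping_hitSet (H : Set M) : IsStopping (hitSet H) := isDetermined_hitSet_le H

theorem isStopping_biSup {ι : Type*} (S : Set ι) {σ : ι → (ℕ → M) → ℕ∞}
    (hσ : ∀ i ∈ S, IsStopping (σ i)) : IsStopping (fun ω => ⨆ i ∈ S, σ i ω) := by
  intro n ω ω' h hω
  simp only [Set.mem_ofPred_eq, iSup_le_iff] at hω ⊢
  exact fun i hi => hσ i hi n ω ω' h (hω i hi)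

theorem isStopping_coverTime (A : Set M) : IsStopping (coverTime A) :=
  isStopping_biSup A fun y _ => isStopping_hitSet {y}

variable [MeasurableSpace M] [Countable M] [DiscreteMeasurableSpace M]

theorem IsStopping.measurable {σ : (ℕ → M) → ℕ∞} (hσ : IsStopping σ) : Measurable σ :=
  ENat.measurable_iff.2 fun n => (hσ.eq n).measurableSet

theorem IsStopping.measurable_toENNReal {σ : (ℕ → M) → ℕ∞} (hσ : IsStopping σ) :
    Measurable fun ω => (σ ω : ℝ≥0∞) :=
  (measurable_of_countable _).comp hσ.measurable

variable (κ : Kernel M M) [IsMarkovKernel κ]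

theorem expect_coverTime_le (x y : M) (A : Set M) :
    expect κ x (coverTime A) ≤ expect κ x (hitTime y) + expect κ y (coverTime A) := by
  refine lintegral_le_of_stopping (isStopping_hitSet {y}).measurable (isStopping_hitSet {y}).eq
    (isStopping_coverTime A).measurable_toENNReal ?_ ?_
  · intro n ω _
    exact_mod_cast ENat.toENNReal_le.2 (coverTime_le_shift A ω n)
  · intro n ω h
    have : ω n = y := (hitSet_eq_coe_iff.1 h).1
    rw [this]
    exact le_rfl

theorem expect_hitTime_triangle (x y z : M) :
    expect κ x (hitTime z) ≤ expect κ x (hitTime y) + expect κ y (hitTime z) := by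
  simpa only [coverTime_singleton] using expect_coverTime_le κ x y {z}

/-- Strong Markov at the entrance into `H`. It is used as a lower bound: reaching a small cluster
takes almost as long as reaching its centre. -/
theorem expect_hitTime_le_hitSet {H : Set M} {b : ℝ≥0∞} {z : M}
    (hb : ∀ y ∈ H, expect κ y (hitTime z) ≤ b) (x : M) :
    expect κ x (hitTime z) ≤ expect κ x (hitSet H) + b := by
  refine lintegral_le_of_stopping (isStopping_hitSet H).measurable (isStopping_hitSet H).eq
    (isStopping_hitSet {z}).measurable_toENNReal ?_ ?_
  · intro n ω _
    exact_mod_cast ENat.toENNReal_le.2 (hitSet_le_shift {z} ω n)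
  · intro n ω h
    exact hb _ (hitSet_eq_coe_iff.1 h).1

theorem expect_hitTime_self (x : M) : expect κ x (hitTime x) = 0 := by
  refine (lintegral_congr_ae ?_).trans lintegral_zero
  filter_upwards [pathLaw_start κ x] with ω h
  have : hitTime x ω = (0 : ℕ) := hitSet_eq_coe_iff.2 ⟨h, by simp⟩
  rw [this]; simp

theorem expect_one_add_shift (x y : M) :
    ∫⁻ ω, ((1 + hitTime y (shift 1 ω) : ℕ∞) : ℝ≥0∞) ∂(pathLaw κ x) =
      1 + ∫⁻ w, expect κ w (hitTime y) ∂(κ x) := by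
  simp only [ENat.toENNReal_add, ENat.toENNReal_one]
  rw [lintegral_add_left measurable_const,
    lintegral_shift_one κ x (Φ := fun ω => (hitTime y ω : ℝ≥0∞))
      (isStopping_hitSet {y}).measurable_toENNReal]
  simp [expect]

theorem expect_returnTime (y : M) :
    expect κ y (returnTime y) = 1 + ∫⁻ w, expect κ w (hitTime y) ∂(κ y) := by
  rw [← expect_one_add_shift]
  simp only [expect, returnTime_eq]

theorem expect_hitTime_step {x y : M} (hxy : x ≠ y) :
    expect κ x (hitTime y) = 1 + ∫⁻ w, expect κ w (hitTime y) ∂(κ x) := by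
  rw [← expect_one_add_shift]
  refine lintegral_congr_ae ?_
  filter_upwards [pathLaw_start κ x] with ω h
  rw [hitTime_eq_hitSet, hitSet_shift (H := {y}) (n := 1) (ω := ω)]
  · rfl
  · intro j hj
    obtain rfl : j = 0 := by omega
    rw [h]; exact hxy

end Hitting

/-! ### Reversibility, the cyclic identity and the potential -/

section Potential

variable {M : Type*} [MeasurableSpace M] (κ : Kernel M M) [IsMarkovKernel κ]

/-- The expected hitting time as a real number. -/
def hitReal (x y : M) : ℝ := (expect κ x (hitTime y)).toReal

theorem hitReal_nonneg (x y : M) : 0 ≤ hitReal κ x y := ENNReal.toReal_nonneg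

variable [Countable M] [DiscreteMeasurableSpace M]

variable {κ} in
-- The states from which the expected hitting time of `y` is finite form a set containing `y` and
-- closed under transitions; at `y` itself closedness is positive recurrence. The chain started at
-- `y` never leaves it, so by irreducibility it is everything.
theorem expect_hitTime_ne_top (hirr : IsIrreducibleChain κ) (hpos : IsPositiveRecurrent κ)
    (x y : M) : expect κ x (hitTime y) ≠ ∞ := by
  set S : Set M := {w | expect κ w (hitTime y) ≠ ∞} with hS
  have hSy : y ∈ S := by simp [hS, expect_hitTime_self]
  have hstep : ∀ w ∈ S, ∀ᵐ u ∂(κ w), u ∈ S := by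
    intro w hw
    have hfin : ∫⁻ u, expect κ u (hitTime y) ∂(κ w) ≠ ∞ := by
      intro h
      by_cases hwy : w = y
      · subst hwy
        have := hpos w
        rw [expect_returnTime, h] at this
        simp at this
      · apply hw
        rw [expect_hitTime_step κ hwy, h]
        simp
    filter_upwards [ae_lt_top (measurable_of_countable _) hfin] with u hu
    exact hu.ne
  have hpow : ∀ n : ℕ, ∀ w ∈ S, (κ ^ n) w Sᶜ = 0 := by
    intro n
    induction n with
    | zero =>
      intro w hw
      rw [pow_zero]
      change Kernel.id w Sᶜ = 0
      rw [Kernel.id_apply, Measure.dirac_apply]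
      simp [hw]
    | succ n ih =>
      intro w hw
      rw [pow_succ]
      change ((κ ^ n) ∘ₖ κ) w Sᶜ = 0
      rw [Kernel.comp_apply' _ _ _ (Set.to_countable _).measurableSet]
      refine (lintegral_congr_ae ?_).trans lintegral_zero
      filter_upwards [hstep w hw] with u hu
      exact ih u hu
  by_contra hx
  have hxS : x ∉ S := fun h => h hx
  obtain ⟨n, hn⟩ := hirr.irreducible (measurableSet_singleton x) (by simp) y
  refine hn.ne' (measure_mono_null ?_ (hpow n y hSy))
  simpa using hxS

theorem hitReal_self (x : M) : hitReal κ x x = 0 := by simp [hitReal, expect_hitTime_self]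

variable {κ}

theorem hitReal_triangle (hfin : ∀ x y, expect κ x (hitTime y) ≠ ∞) (x y z : M) :
    hitReal κ x z ≤ hitReal κ x y + hitReal κ y z := by
  unfold hitReal
  rw [← ENNReal.toReal_add (hfin x y) (hfin y z)]
  exact ENNReal.toReal_mono (ENNReal.add_ne_top.2 ⟨hfin x y, hfin y z⟩)
    (expect_hitTime_triangle κ x y z)

theorem lintegral_hitTime_ne_top (hfin : ∀ x y, expect κ x (hitTime y) ≠ ∞)
    (hpos : IsPositiveRecurrent κ) (x z : M) : ∫⁻ w, expect κ w (hitTime z) ∂(κ x) ≠ ∞ := by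
  intro h
  by_cases hxz : x = z
  · subst hxz
    have := hpos x
    rw [expect_returnTime, h] at this
    simp at this
  · apply hfin x z
    rw [expect_hitTime_step κ hxz, h]
    simp

theorem integrable_hitReal (hfin : ∀ x y, expect κ x (hitTime y) ≠ ∞)
    (hpos : IsPositiveRecurrent κ) (x z : M) : Integrable (fun w => hitReal κ w z) (κ x) :=
  integrable_toReal_of_lintegral_ne_top (measurable_of_countable _).aemeasurable
    (lintegral_hitTime_ne_top hfin hpos x z)

open Classical in
-- The Poisson equation for h(·,z): the generator gives -1, corrected at `z` by the mean return
-- time.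
theorem integral_hitReal (hfin : ∀ x y, expect κ x (hitTime y) ≠ ∞)
    (hpos : IsPositiveRecurrent κ) (x z : M) : ∫ w, hitReal κ w z ∂(κ x) =
    hitReal κ x z - 1 + if x = z then (expect κ z (returnTime z)).toReal else 0 := by
  have h0 : ∫ w, hitReal κ w z ∂(κ x) = (∫⁻ w, expect κ w (hitTime z) ∂(κ x)).toReal :=
    integral_toReal (measurable_of_countable _).aemeasurable
      (ae_of_all _ fun w => (hfin w z).lt_top)
  have h1 := lintegral_hitTime_ne_top hfin hpos x z
  rw [h0]
  by_cases hxz : x = z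
  · subst hxz
    rw [if_pos rfl, hitReal_self, expect_returnTime, ENNReal.toReal_add ENNReal.one_ne_top h1]
    simp
  · rw [if_neg hxz, hitReal, expect_hitTime_step κ hxz, ENNReal.toReal_add ENNReal.one_ne_top h1]
    simp

theorem IsReversible.compProd_swap {π : Measure M} [IsProbabilityMeasure π]
    (hπ : κ.IsReversible π) : (π ⊗ₘ κ).map Prod.swap = π ⊗ₘ κ := by
  refine Measure.ext_of_singleton fun p => ?_
  obtain ⟨x, y⟩ := p
  rw [Measure.map_apply measurable_swap (measurableSet_singleton _)]
  have h1 : (Prod.swap ⁻¹' {(x, y)} : Set (M × M)) = {y} ×ˢ {x} := by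
    ext ⟨a, b⟩; simp [and_comm]
  have h2 : ({(x, y)} : Set (M × M)) = {x} ×ˢ {y} := by simp
  rw [h1, h2, Measure.compProd_apply_prod (measurableSet_singleton _) (measurableSet_singleton _),
    Measure.compProd_apply_prod (measurableSet_singleton _) (measurableSet_singleton _)]
  exact hπ (measurableSet_singleton _) (measurableSet_singleton _)

/-- A reversible kernel is symmetric on bounded functions. -/
theorem IsReversible.integral_mul_comm {π : Measure M} [IsProbabilityMeasure π]
    (hπ : κ.IsReversible π) {f g : M → ℝ} {C D : ℝ} (hf : ∀ x, |f x| ≤ C) (hg : ∀ x, |g x| ≤ D) :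
    ∫ x, f x * ∫ y, g y ∂(κ x) ∂π = ∫ x, (∫ y, f y ∂(κ x)) * g x ∂π := by
  have hi : ∀ {f g : M → ℝ} {C D : ℝ}, (∀ x, |f x| ≤ C) → (∀ x, |g x| ≤ D) →
      Integrable (fun p : M × M => f p.1 * g p.2) (π ⊗ₘ κ) := by
    intro f g C D hf hg
    refine Integrable.of_bound (measurable_of_countable _).aestronglyMeasurable (C * D)
      (ae_of_all _ fun p => ?_)
    rw [Real.norm_eq_abs, abs_mul]
    exact mul_le_mul (hf _) (hg _) (abs_nonneg _) ((abs_nonneg _).trans (hf p.1))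
  have h1 := Measure.integral_compProd (hi hf hg)
  have h2 := Measure.integral_compProd (hi hg hf)
  simp only [integral_const_mul] at h1 h2
  have h3 : ∫ p, f p.1 * g p.2 ∂(π ⊗ₘ κ) = ∫ p, g p.1 * f p.2 ∂(π ⊗ₘ κ) := by
    conv_lhs => rw [← IsReversible.compProd_swap hπ]
    rw [integral_map measurable_swap.aemeasurable (measurable_of_countable _).aestronglyMeasurable]
    refine integral_congr_ae (ae_of_all _ fun p => ?_)
    simp [mul_comm]
  rw [← h1, h3, h2]
  refine integral_congr_ae (ae_of_all _ fun x => ?_)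
  simp [mul_comm]

/-- The cyclic identity for the hitting times of a reversible chain. -/
theorem hitReal_cyclic (hirr : IsIrreducibleChain κ) (hpos : IsPositiveRecurrent κ)
    (hrev : IsReversibleChain κ) (o y z : M) :
    hitReal κ o y + hitReal κ y z + hitReal κ z o =
      hitReal κ o z + hitReal κ z y + hitReal κ y o := by
  classical
  obtain ⟨π, hπ1, hπ⟩ := hrev
  have hfin := expect_hitTime_ne_top hirr hpos
  set c : M → ℝ := fun z => (expect κ z (returnTime z)).toReal with hc
  -- Hitting times need not be bounded or π-integrable, but by the triangle inequality these
  -- differences are bounded. In the Poisson equation the constants -1 cancel, leaving only point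
  -- masses at `z` and `o`.
  set f : M → M → ℝ := fun z x => hitReal κ x z - hitReal κ x o with hfdef
  have hbd : ∀ z x, |f z x| ≤ hitReal κ z o + hitReal κ o z := by
    intro z x
    have h1 := hitReal_triangle hfin x o z
    have h2 := hitReal_triangle hfin x z o
    have h3 := hitReal_nonneg κ z o
    have h4 := hitReal_nonneg κ o z
    rw [abs_le]
    constructor <;> simp only [hfdef] <;> linarith
  have hP : ∀ z x, ∫ w, f z w ∂(κ x) =
      f z x + ((if x = z then c z else 0) - if x = o then c o else 0) := by
    intro z x
    simp only [hfdef]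
    rw [integral_sub (integrable_hitReal hfin hpos x z) (integrable_hitReal hfin hpos x o),
      integral_hitReal hfin hpos, integral_hitReal hfin hpos]
    ring
  have hint : ∀ {g : M → ℝ} {C : ℝ}, (∀ x, |g x| ≤ C) → Integrable g π := fun {g C} hg =>
    Integrable.of_bound (measurable_of_countable _).aestronglyMeasurable C
      (ae_of_all _ fun x => by simpa using hg x)
  have hpt : ∀ (g : M → ℝ) (z : M) (a : ℝ),
      ∫ x, g x * (if x = z then a else 0) ∂π = g z * a * π.real {z} := by
    intro g z a
    have : (fun x => g x * (if x = z then a else 0)) =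
        ({z} : Set M).indicator (fun _ => g z * a) := by
      ext x
      by_cases hx : x = z
      · subst hx; simp
      · simp [hx]
    rw [this, integral_indicator_const _ (measurableSet_singleton z)]
    simp [mul_comm]
  have hpi : ∀ (g : M → ℝ) (z : M) (a : ℝ),
      Integrable (fun x => g x * (if x = z then a else 0)) π := by
    intro g z a
    refine hint (C := |g z * a|) fun x => ?_
    by_cases hx : x = z
    · subst hx; simp
    · simp only [hx, if_false, mul_zero, abs_zero]; positivity
  have hgP : ∀ (g : M → ℝ) (C : ℝ) (z : M), (∀ x, |g x| ≤ C) →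
      ∫ x, g x * ∫ w, f z w ∂(κ x) ∂π =
        ∫ x, g x * f z x ∂π + (g z * c z * π.real {z} - g o * c o * π.real {o}) := by
    intro g C z hg
    have hgf : Integrable (fun x => g x * f z x) π :=
      hint (C := C * (hitReal κ z o + hitReal κ o z)) fun x => by
        rw [abs_mul]
        exact mul_le_mul (hg _) (hbd _ _) (abs_nonneg _) ((abs_nonneg _).trans (hg x))
    simp only [hP, mul_add, mul_sub]
    have hsub : Integrable (fun x => g x * (if x = z then c z else 0) -
        g x * (if x = o then c o else 0)) π := (hpi g z (c z)).sub (hpi g o (c o))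
    rw [integral_add hgf hsub,
      integral_sub (hpi g z (c z)) (hpi g o (c o)), hpt, hpt]
  -- Symmetry tested against the constant 1 shows that the point masses have the same π-weight for
  -- all states. Only the fact that this weight is nonzero is needed, not its value.
  have hK : ∀ z, c z * π.real {z} = c o * π.real {o} := by
    intro z
    have h1 := hgP (fun _ => 1) 1 z (by simp)
    have h2 := IsReversible.integral_mul_comm hπ (f := fun _ => 1) (g := f z) (C := 1)
      (by simp) (hbd z)
    simp only [integral_const, probReal_univ, smul_eq_mul, mul_one, one_mul] at h1 h2
    linarith
  have hKne : c o * π.real {o} ≠ 0 := by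
    intro h0
    have hz : ∀ z, π {z} = 0 := by
      intro z
      have h1 := hK z
      rw [h0] at h1
      have h2 : c z ≠ 0 := by
        simp only [hc]
        rw [ENNReal.toReal_ne_zero]
        refine ⟨?_, (hpos z).ne⟩
        rw [expect_returnTime]
        simp
      have h3 := (mul_eq_zero.1 h1).resolve_left h2
      rwa [measureReal_eq_zero_iff] at h3
    have : π Set.univ = 0 := by
      rw [← Set.iUnion_of_singleton M]
      exact measure_iUnion_null hz
    simp at this
  have e1 := hgP (f y) _ z (hbd y)
  have e2 := hgP (f z) _ y (hbd z)
  have e3 := IsReversible.integral_mul_comm hπ (hbd y) (hbd z)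
  have e4 : ∫ x, f z x * ∫ w, f y w ∂(κ x) ∂π = ∫ x, (∫ w, f y w ∂(κ x)) * f z x ∂π :=
    integral_congr_ae (ae_of_all _ fun x => mul_comm _ _)
  have e5 : ∫ x, f z x * f y x ∂π = ∫ x, f y x * f z x ∂π :=
    integral_congr_ae (ae_of_all _ fun x => mul_comm _ _)
  -- Equating ∫ `f y` · P `f z` with ∫ `f z` · P `f y` leaves only the point-mass terms.
  have e6 : c o * π.real {o} * (f y z - f y o) = c o * π.real {o} * (f z y - f z o) := by
    have := hK y
    have := hK z
    rw [mul_assoc, mul_assoc] at e1 e2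
    rw [hK] at e1 e2
    linear_combination e3 - e4 + e5 - e1 + e2
  have e7 := mul_left_cancel₀ hKne e6
  simp only [hfdef, hitReal_self] at e7
  linarith

/-- By the cyclic identity the antisymmetric part of h is additive around triangles; measuring it
from a base point `o` gives f. -/
theorem exists_potential (hirr : IsIrreducibleChain κ) (hpos : IsPositiveRecurrent κ)
    (hrev : IsReversibleChain κ) :
    ∃ f : M → ℝ, ∀ x y, hitReal κ x y - hitReal κ y x = f x - f y := by
  rcases isEmpty_or_nonempty M with h | ⟨⟨o⟩⟩
  · exact ⟨fun _ => 0, fun x => (h.false x).elim⟩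
  · refine ⟨fun x => hitReal κ x o - hitReal κ o x, fun x y => ?_⟩
    have := hitReal_cyclic hirr hpos hrev o y x
    linarith

end Potential

/-! ### Matthews' bound for clusters -/

section Clusters

variable {M ι : Type*}

/-- The first time at which all the clusters `H l`, `l ∈ S`, have been visited. -/
def clusterTime (H : ι → Set M) (S : Finset ι) (ω : ℕ → M) : ℕ∞ := ⨆ l ∈ S, hitSet (H l) ω

theorem hitSet_le_clusterTime {H : ι → Set M} {S : Finset ι} {l : ι} (hl : l ∈ S) (ω : ℕ → M) :
    hitSet (H l) ω ≤ clusterTime H S ω :=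
  le_iSup₂ (f := fun l (_ : l ∈ S) => hitSet (H l) ω) l hl

theorem clusterTime_le_iff {H : ι → Set M} {S : Finset ι} {ω : ℕ → M} {a : ℕ∞} :
    clusterTime H S ω ≤ a ↔ ∀ l ∈ S, hitSet (H l) ω ≤ a := iSup₂_le_iff

theorem exists_hitSet_eq_clusterTime (H : ι → Set M) {S : Finset ι} (hS : S.Nonempty)
    (ω : ℕ → M) : ∃ l ∈ S, hitSet (H l) ω = clusterTime H S ω := by
  obtain ⟨l, hl, h⟩ := S.exists_max_image (fun l => hitSet (H l) ω) hS
  exact ⟨l, hl, le_antisymm (hitSet_le_clusterTime hl ω) (clusterTime_le_iff.2 h)⟩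

theorem isStopping_clusterTime (H : ι → Set M) (S : Finset ι) : IsStopping (clusterTime H S) :=
  isStopping_biSup (S : Set ι) fun l _ => isStopping_hitSet (H l)

/-- Some cluster is visited strictly after all the others. -/
theorem exists_last_cluster [DecidableEq ι] {H : ι → Set M} {S : Finset ι} (hS : S.Nonempty)
    (hdisj : ∀ k ∈ S, ∀ l ∈ S, k ≠ l → Disjoint (H k) (H l)) {ω : ℕ → M}
    (h0 : ∀ l ∈ S, ω 0 ∉ H l) (hω : clusterTime H S ω ≠ ⊤) :
    ∃ l ∈ S, clusterTime H (S.erase l) ω < hitSet (H l) ω ∧ clusterTime H (S.erase l) ω ≠ ⊤ := by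
  obtain ⟨l, hl, h⟩ := exists_hitSet_eq_clusterTime H hS ω
  obtain ⟨n, hn⟩ := ENat.ne_top_iff_exists.1 hω
  have hln : hitSet (H l) ω = n := h.trans hn.symm
  have hlt : clusterTime H (S.erase l) ω < n := by
    cases n with
    | zero => exact absurd (hitSet_eq_coe_iff.1 hln).1 (h0 l hl)
    | succ m =>
      refine lt_of_le_of_lt (b := (m : ℕ∞)) ?_ (by exact_mod_cast Nat.lt_succ_self m)
      refine clusterTime_le_iff.2 fun k hk => ?_
      obtain ⟨hkl, hkS⟩ := Finset.mem_erase.1 hk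
      have h1 : hitSet (H k) ω ≤ (m + 1 : ℕ) := by
        rw [hn]; exact hitSet_le_clusterTime hkS ω
      -- Disjoint clusters cannot be entered at the same instant, so there are no ties.
      have h2 : hitSet (H k) ω ≠ (m + 1 : ℕ) := fun h2 =>
        Set.disjoint_left.1 (hdisj k hkS l hl hkl) (hitSet_eq_coe_iff.1 h2).1
          (hitSet_eq_coe_iff.1 hln).1
      have h3 := lt_of_le_of_ne h1 h2
      rwa [Nat.cast_succ, ENat.lt_add_one_iff (ENat.natCast_ne_top m)] at h3
  exact ⟨l, hl, by rwa [hln], (hlt.trans_le le_top).ne⟩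

variable [MeasurableSpace M] [Countable M] [DiscreteMeasurableSpace M]
  {κ : Kernel M M} [IsMarkovKernel κ]

theorem measurable_of_start {F : M → (ℕ → M) → ℝ≥0∞} (hF : ∀ y, Measurable (F y)) :
    Measurable fun ω : ℕ → M => F (ω 0) ω := by
  have h : Measurable (Function.uncurry F) := measurable_from_prod_countable_right hF
  have h2 : Measurable fun ω : ℕ → M => ((ω 0, ω) : M × (ℕ → M)) :=
    (measurable_pi_apply 0).prodMk measurable_id
  exact h.comp h2

theorem expect_hitSet_of_mem {H : Set M} {x : M} (hx : x ∈ H) : expect κ x (hitSet H) = 0 := by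
  refine (lintegral_congr_ae ?_).trans lintegral_zero
  filter_upwards [pathLaw_start κ x] with ω h
  have : hitSet H ω = (0 : ℕ) := hitSet_eq_coe_iff.2 ⟨by rwa [h], by simp⟩
  rw [this]; simp

theorem ae_ne_top_of_expect_ne_top {x : M} {σ : (ℕ → M) → ℕ∞} (hσ : IsStopping σ)
    (h : expect κ x σ ≠ ∞) : ∀ᵐ ω ∂(pathLaw κ x), σ ω ≠ ⊤ := by
  filter_upwards [ae_lt_top hσ.measurable_toENNReal h] with ω hω
  exact (ENat.toENNReal_lt_top.1 hω).ne

/-- Strong Markov at the time when all clusters other than `l` have been seen. If `H l` is still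
unseen, the chain is then in another cluster, or still at its starting point `x` if `l` is the only
one; in either case reaching `H l` costs at least `b` more. -/
theorem expect_clusterTime_erase_le [DecidableEq ι] {H : ι → Set M} {S : Finset ι} {x : M}
    {b : ℝ≥0∞} {l : ι} (hl : l ∈ S)
    (hb : ∀ y, (y = x ∨ ∃ k ∈ S, k ≠ l ∧ y ∈ H k) → b ≤ expect κ y (hitSet (H l))) :
    expect κ x (clusterTime H (S.erase l)) +
        b * pathLaw κ x {ω | ω ∈ {ω | clusterTime H (S.erase l) ω < hitSet (H l) ω} ∧
          clusterTime H (S.erase l) ω ≠ ⊤} ≤ expect κ x (clusterTime H S) := by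
  have hσ := isStopping_clusterTime H (S.erase l)
  refine le_lintegral_of_stopping (Φ := fun ω => (hitSet (H l) ω : ℝ≥0∞)) hσ.measurable ?_
    (isStopping_hitSet _).measurable_toENNReal ?_ ?_ ?_
  · intro n
    have : {ω | ω ∈ {ω | clusterTime H (S.erase l) ω < hitSet (H l) ω} ∧
        clusterTime H (S.erase l) ω = n} =
        {ω | clusterTime H (S.erase l) ω = n} ∩ {ω | hitSet (H l) ω ≤ n}ᶜ := by
      ext ω
      simp only [Set.mem_ofPred_eq, Set.mem_inter_iff, Set.mem_compl_iff, not_le]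
      constructor
      · rintro ⟨h1, h2⟩; exact ⟨h2, h2 ▸ h1⟩
      · rintro ⟨h1, h2⟩; exact ⟨by rwa [h1], h1⟩
    rw [this]
    exact (hσ.eq n).inter (isDetermined_compl (isDetermined_hitSet_le _ n))
  · intro ω
    refine ENat.toENNReal_le.2 (clusterTime_le_iff.2 fun k hk => ?_)
    exact hitSet_le_clusterTime (Finset.mem_of_mem_erase hk) ω
  · intro n ω hω hn
    have h1 : (n : ℕ∞) < hitSet (H l) ω := by rw [← hn]; exact hω
    have h2 := hitSet_shift (H := H l) (n := n) (ω := ω) fun j hj => lt_hitSet_iff.1 h1 j hj.le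
    have h3 := hitSet_le_clusterTime (H := H) hl ω
    rw [h2] at h3
    exact_mod_cast ENat.toENNReal_le.2 h3
  · intro n ω h0 hω hn
    refine hb _ ?_
    rcases (S.erase l).eq_empty_or_nonempty with he | hne
    · left
      have : n = 0 := by
        have : clusterTime H (S.erase l) ω = 0 := by simp [clusterTime, he]
        exact_mod_cast hn.symm.trans this
      rw [this, h0]
    · right
      obtain ⟨k, hk, h1⟩ := exists_hitSet_eq_clusterTime H hne ω
      exact ⟨k, Finset.mem_of_mem_erase hk, Finset.ne_of_mem_erase hk,
        (hitSet_eq_coe_iff.1 (h1.trans hn)).1⟩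

/-- Matthews' lower bound for the time needed to visit a family of disjoint clusters. -/
theorem matthews_le_expect_clusterTime [DecidableEq ι] {H : ι → Set M} {x : M} {b : ℝ≥0∞}
    (S : Finset ι) (hdisj : ∀ k ∈ S, ∀ l ∈ S, k ≠ l → Disjoint (H k) (H l))
    (hb : ∀ l ∈ S, ∀ y, (y = x ∨ ∃ k ∈ S, k ≠ l ∧ y ∈ H k) → b ≤ expect κ y (hitSet (H l))) :
    b * ENNReal.ofReal (harmonic S.card) ≤ expect κ x (clusterTime H S) := by
  by_cases hb0 : b = 0
  · simp [hb0]
  induction hS : S.card generalizing S with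
  | zero => simp
  | succ k ih =>
    have hne : S.Nonempty := Finset.card_pos.1 (by omega)
    by_cases htop : expect κ x (clusterTime H S) = ∞
    · rw [htop]; exact le_top
    have h1 : ∀ l ∈ S, b * ENNReal.ofReal (harmonic k) ≤
        expect κ x (clusterTime H (S.erase l)) := by
      intro l hl
      refine ih (S.erase l) ?_ ?_ (by rw [Finset.card_erase_of_mem hl, hS]; rfl)
      · exact fun i hi j hj => hdisj i (Finset.mem_of_mem_erase hi) j (Finset.mem_of_mem_erase hj)
      · intro i hi y hy
        refine hb i (Finset.mem_of_mem_erase hi) y (hy.imp_right ?_)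
        rintro ⟨j, hj, h⟩
        exact ⟨j, Finset.mem_of_mem_erase hj, h⟩
    set E : ι → Set (ℕ → M) := fun l =>
      {ω | ω ∈ {ω | clusterTime H (S.erase l) ω < hitSet (H l) ω} ∧
        clusterTime H (S.erase l) ω ≠ ⊤} with hE
    -- Almost surely some cluster comes strictly last. The start lies in no cluster, because `b` is
    -- nonzero.
    have h2 : 1 ≤ ∑ l ∈ S, pathLaw κ x (E l) := by
      refine le_trans ?_ (measure_biUnion_finset_le S E)
      refine le_of_eq_of_le (measure_univ (μ := pathLaw κ x)).symm (measure_mono_ae ?_)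
      filter_upwards [ae_ne_top_of_expect_ne_top (isStopping_clusterTime H S) htop,
        pathLaw_start κ x] with ω h3 h4 _
      obtain ⟨l, hl, h5⟩ := exists_last_cluster hne hdisj (ω := ω) (fun l hl h6 => hb0 (by
        have := hb l hl x (Or.inl rfl)
        rwa [expect_hitSet_of_mem (h4 ▸ h6), nonpos_iff_eq_zero] at this)) h3
      exact Set.mem_biUnion (show l ∈ (S : Set ι) from hl) h5
    -- Averaging over the erased cluster replaces the usual random ordering: the induction
    -- hypothesis gives b·H_k for each `l`, and the events `E l` add at least `b` in total, that is
    -- b/(k+1) after division by the number of clusters.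
    have h3 : ∑ l ∈ S, (b * ENNReal.ofReal (harmonic k) + b * pathLaw κ x (E l)) ≤
        ∑ l ∈ S, expect κ x (clusterTime H S) :=
      Finset.sum_le_sum fun l hl =>
        (add_le_add (h1 l hl) le_rfl).trans (expect_clusterTime_erase_le hl (hb l hl))
    rw [Finset.sum_add_distrib, ← Finset.mul_sum, Finset.sum_const, Finset.sum_const, hS,
      nsmul_eq_mul, nsmul_eq_mul] at h3
    have hk0 : ((k + 1 : ℕ) : ℝ≥0∞) ≠ 0 := by simp
    have hk1 : ((k + 1 : ℕ) : ℝ≥0∞) ≠ ∞ := ENNReal.natCast_ne_top _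
    refine (ENNReal.mul_le_mul_iff_right hk0 hk1).1 (le_trans ?_ h3)
    have hh : ENNReal.ofReal (harmonic (k + 1)) =
        ENNReal.ofReal (harmonic k) + ((k + 1 : ℕ) : ℝ≥0∞)⁻¹ := by
      rw [harmonic_succ]
      push_cast
      rw [ENNReal.ofReal_add, ENNReal.ofReal_inv_of_pos (by positivity)]
      · congr 2
        exact_mod_cast ENNReal.ofReal_natCast (k + 1)
      · unfold harmonic
        push_cast
        positivity
      · positivity
    rw [hh, mul_add, mul_add]
    refine add_le_add (mul_left_comm _ _ _).le ?_
    rw [mul_left_comm, ENNReal.mul_inv_cancel hk0 hk1]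
    rw [← Finset.mul_sum]
    exact mul_le_mul' le_rfl h2

/-- After the last cluster is reached, it still has to be covered. -/
theorem expect_clusterTime_add_le {H : ι → Set M} {S : Finset ι} (hS : S.Nonempty)
    (hdisj : ∀ k ∈ S, ∀ l ∈ S, k ≠ l → Disjoint (H k) (H l)) {A : Set M}
    (hA : ∀ l ∈ S, H l ⊆ A) (hne : ∀ l ∈ S, (H l).Nonempty) {x : M} {b : ℝ≥0∞}
    (hb : ∀ l ∈ S, ∀ y ∈ H l, b ≤ expect κ y (coverTime (H l))) :
    expect κ x (clusterTime H S) + b ≤ expect κ x (coverTime A) := by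
  classical
  have hσ := isStopping_clusterTime H S
  have hle : ∀ ω, clusterTime H S ω ≤ coverTime A ω := fun ω =>
    clusterTime_le_iff.2 fun l hl =>
      (hitSet_le_coverTime (hne l hl) ω).trans (coverTime_mono (hA l hl) ω)
  by_cases htop : expect κ x (clusterTime H S) = ∞
  · have := expect_mono κ hle x
    rw [htop, top_le_iff] at this
    rw [this]; exact le_top
  -- `K y` is the cluster containing `y`, unambiguous by disjointness. It makes the time still to be
  -- spent a function of the shifted path alone.
  obtain ⟨K, hKeq⟩ : ∃ K : M → Set M, ∀ l ∈ S, ∀ y ∈ H l, K y = H l := by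
    refine ⟨fun y => if h : ∃ l ∈ S, y ∈ H l then H h.choose else ∅, fun l hl y hy => ?_⟩
    have h : ∃ l ∈ S, y ∈ H l := ⟨l, hl, hy⟩
    simp only [dif_pos h]
    by_contra hne
    have h1 := h.choose_spec
    have hcl : h.choose ≠ l := fun h2 => hne (by rw [h2])
    exact Set.disjoint_left.1 (hdisj _ h1.1 l hl hcl) h1.2 hy
  have hmem : ∀ (n : ℕ) ω, clusterTime H S ω = n →
      ∃ l ∈ S, hitSet (H l) ω = n ∧ K (ω n) = H l ∧ ω n ∈ H l := by
    intro n ω hn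
    obtain ⟨l, hl, h1⟩ := exists_hitSet_eq_clusterTime H hS ω
    have h2 := (hitSet_eq_coe_iff.1 (h1.trans hn)).1
    exact ⟨l, hl, h1.trans hn, hKeq l hl _ h2, h2⟩
  have hΦ : Measurable fun ω : ℕ → M => (coverTime (K (ω 0)) ω : ℝ≥0∞) := by
    exact measurable_of_start (F := fun y ω => (coverTime (K y) ω : ℝ≥0∞))
      fun y => (isStopping_coverTime (K y)).measurable_toENNReal
  have key := le_lintegral_of_stopping (κ := κ) (x := x) (E := Set.univ) (b := b)
    (Φ := fun ω : ℕ → M => (coverTime (K (ω 0)) ω : ℝ≥0∞))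
    (Ψ := fun ω => (coverTime A ω : ℝ≥0∞)) hσ.measurable
    (fun n => by simpa using hσ.eq n) hΦ (fun ω => ENat.toENNReal_le.2 (hle ω)) ?_ ?_
  · have h1 : pathLaw κ x {ω | ω ∈ Set.univ ∧ clusterTime H S ω ≠ ⊤} = 1 := by
      rw [← measure_univ (μ := pathLaw κ x)]
      refine measure_congr ?_
      filter_upwards [ae_ne_top_of_expect_ne_top hσ htop] with ω hω
      exact propext (iff_of_true ⟨trivial, hω⟩ trivial)
    rwa [h1, mul_one] at key
  · intro n ω _ hn
    obtain ⟨l, hl, h1, h2, h3⟩ := hmem n ω hn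
    have h4 : shift n ω 0 = ω n := rfl
    rw [h4, h2]
    have h5 := (coverTime_shift (hne l hl) (hitSet_eq_coe_iff.1 h1).2).trans
      (coverTime_mono (hA l hl) ω)
    exact_mod_cast ENat.toENNReal_le.2 h5
  · intro n ω _ _ hn
    obtain ⟨l, hl, h1, h2, h3⟩ := hmem n ω hn
    refine (hb l hl _ h3).trans (le_of_eq (lintegral_congr_ae ?_))
    filter_upwards [pathLaw_start κ (ω n)] with ω' h'
    rw [h', h2]

end Clusters

/-! ### The growth condition for cov -/

section Growth

theorem half_le_harmonic_two_pow (p : ℕ) : (p : ℝ) / 2 ≤ harmonic (2 ^ p) := by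
  have h1 := log_add_one_le_harmonic (2 ^ p)
  have h2 : Real.log (2 ^ p) ≤ Real.log ((2 ^ p : ℕ) + 1) := by
    refine Real.log_le_log (by positivity) ?_
    push_cast
    linarith
  rw [Real.log_pow] at h2
  have h3 := Real.log_two_gt_d9
  have h4 : (p : ℝ) / 2 ≤ p * Real.log 2 := by
    have : (0 : ℝ) ≤ p := p.cast_nonneg
    nlinarith
  push_cast at h1 h2 ⊢
  linarith

theorem harmonic_mono {m n : ℕ} (h : m ≤ n) : harmonic m ≤ harmonic n := by
  unfold harmonic
  refine Finset.sum_le_sum_of_subset_of_nonneg (Finset.range_mono h) fun i _ _ => ?_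
  positivity

/-- `ENNReal.ofReal` truncates at 0, which only strengthens the hypotheses, so `p` and `q` may be
negative. -/
theorem add_le_toReal_of_ofReal_add_le {p q : ℝ} {r s : ℝ≥0∞} (hs : s ≠ ∞)
    (hr : ENNReal.ofReal p ≤ r) (h : r + ENNReal.ofReal q ≤ s) : p + q ≤ s.toReal := by
  have h1 := ENNReal.toReal_mono hs ((add_le_add hr le_rfl).trans h)
  rw [ENNReal.toReal_add ENNReal.ofReal_ne_top ENNReal.ofReal_ne_top] at h1
  rw [ENNReal.toReal_ofReal', ENNReal.toReal_ofReal'] at h1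
  linarith [le_max_left p 0, le_max_left q 0]

variable {M : Type*} [MeasurableSpace M]

theorem expect_le_cov (κ : Kernel M M) [IsMarkovKernel κ] {A : Set M} {x : M} (hx : x ∈ A) :
    expect κ x (coverTime A) ≤ cov κ A :=
  le_iSup₂ (f := fun x (_ : x ∈ A) => expect κ x (coverTime A)) x hx

theorem cov_mono (κ : Kernel M M) [IsMarkovKernel κ] {A B : Set M} (h : A ⊆ B) :
    cov κ A ≤ cov κ B :=
  iSup₂_le fun x hx => (expect_mono κ (coverTime_mono h) x).trans (expect_le_cov κ (h hx))

theorem expect_hitTime_le_cov (κ : Kernel M M) [IsMarkovKernel κ] {A : Set M} {x y : M}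
    (hx : x ∈ A) (hy : y ∈ A) : expect κ x (hitTime y) ≤ cov κ A :=
  (expect_mono κ (hitTime_le_coverTime hy) x).trans (expect_le_cov κ hx)

/-- The commute distance as a real number. -/
def commuteReal (κ : Kernel M M) [IsMarkovKernel κ] (x y : M) : ℝ :=
  hitReal κ x y + hitReal κ y x

theorem commute_eq_ofReal {κ : Kernel M M} [IsMarkovKernel κ]
    (hfin : ∀ x y, expect κ x (hitTime y) ≠ ∞) (x y : M) :
    commute κ x y = ENNReal.ofReal (commuteReal κ x y) := by
  unfold commute commuteReal hitReal
  rw [ENNReal.ofReal_add ENNReal.toReal_nonneg ENNReal.toReal_nonneg,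
    ENNReal.ofReal_toReal (hfin x y), ENNReal.ofReal_toReal (hfin y x)]

theorem commuteReal_comm (κ : Kernel M M) [IsMarkovKernel κ] (x y : M) :
    commuteReal κ x y = commuteReal κ y x := add_comm _ _

theorem hitReal_le_commuteReal (κ : Kernel M M) [IsMarkovKernel κ] (x y : M) :
    hitReal κ x y ≤ commuteReal κ x y := by
  have := hitReal_nonneg κ y x
  unfold commuteReal
  linarith

/-- A point set with many elements has a large subset on which a function of moderate range is
almost constant. -/
theorem exists_large_almost_constant {n : ℕ} (hn : 4 ≤ n) {a : ℝ} (ha : 0 < a)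
    (g : Fin (2 ^ 2 ^ n) → ℝ) (hg : ∀ k l, g k - g l < a * 2 ^ n) :
    ∃ S : Finset (Fin (2 ^ 2 ^ n)), 2 ^ 2 ^ (n - 1) < S.card ∧
      ∀ k ∈ S, ∀ l ∈ S, g k - g l ≤ a / 4 := by
  obtain ⟨i, _, hi⟩ := Finset.exists_min_image Finset.univ g
    ⟨⟨0, by positivity⟩, Finset.mem_univ _⟩
  have hmaps : ∀ l ∈ (Finset.univ : Finset (Fin (2 ^ 2 ^ n))),
      ⌊(g l - g i) / (a / 4)⌋₊ ∈ Finset.range (4 * 2 ^ n) := by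
    intro l _
    rw [Finset.mem_range, Nat.floor_lt' (by positivity), div_lt_iff₀ (by positivity)]
    push_cast
    have := hg l i
    linarith
  have hcard : (Finset.range (4 * 2 ^ n)).card * 2 ^ 2 ^ (n - 1) <
      (Finset.univ : Finset (Fin (2 ^ 2 ^ n))).card := by
    rw [Finset.card_range, Finset.card_univ, Fintype.card_fin]
    have h1 : 4 * 2 ^ n * 2 ^ 2 ^ (n - 1) = 2 ^ (2 + n + 2 ^ (n - 1)) := by
      rw [pow_add, pow_add]; norm_num
    rw [h1]
    -- The range of `g` is cut into 4·2^n intervals of length a/4. Pigeonhole requires n + 2 <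
    -- 2^(n-1), whence the restriction to n ≥ 4.
    refine Nat.pow_lt_pow_right (by norm_num) ?_
    obtain ⟨m, rfl⟩ := Nat.exists_eq_add_of_le hn
    have h2 : 4 + m - 1 = m + 3 := by omega
    have h3 : m + 1 ≤ 2 ^ m := Nat.lt_two_pow_self
    rw [h2, pow_add, pow_add]
    omega
  obtain ⟨j, _, hj⟩ := Finset.exists_lt_card_fiber_of_mul_lt_card_of_maps_to hmaps hcard
  refine ⟨_, hj, fun k hk l hl => ?_⟩
  have hk' := (Finset.mem_filter.1 hk).2
  have hl' := (Finset.mem_filter.1 hl).2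
  have h1 : (g k - g i) / (a / 4) < j + 1 := by
    rw [← hk']; exact Nat.lt_floor_add_one _
  have h2 : (j : ℝ) ≤ (g l - g i) / (a / 4) := by
    rw [← hl']
    exact Nat.floor_le (div_nonneg (sub_nonneg.2 (hi l (Finset.mem_univ _))) (by positivity))
  rw [div_lt_iff₀ (by positivity)] at h1
  rw [le_div_iff₀ (by positivity)] at h2
  linarith

variable [Countable M] [DiscreteMeasurableSpace M]
  {κ : Kernel M M} [IsMarkovKernel κ]

theorem commuteReal_triangle (hfin : ∀ x y, expect κ x (hitTime y) ≠ ∞) (x y z : M) :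
    commuteReal κ x z ≤ commuteReal κ x y + commuteReal κ y z := by
  have h1 := hitReal_triangle hfin x y z
  have h2 := hitReal_triangle hfin z y x
  unfold commuteReal
  linarith

/-- The growth condition for the functional `cov` of a reversible chain. -/
theorem cov_growth (hirr : IsIrreducibleChain κ) (hpos : IsPositiveRecurrent κ)
    (hrev : IsReversibleChain κ) {A : Set M} (hA : cov κ A ≠ ∞) {n : ℕ} (hn : 4 ≤ n) {a β : ℝ}
    (ha : 0 < a) (t : Fin (2 ^ 2 ^ n) → M) (H : Fin (2 ^ 2 ^ n) → Set M) (ht : ∀ l, t l ∈ H l)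
    (hsub : ∀ l, H l ⊆ A) (hsep : ∀ k l, k ≠ l → a ≤ commuteReal κ (t k) (t l))
    (hball : ∀ l, ∀ y ∈ H l, commuteReal κ y (t l) ≤ a / 16)
    (hβ : ∀ l, β ≤ (cov κ (H l)).toReal) :
    a * 2 ^ n / 32 + β ≤ (cov κ A).toReal := by
  classical
  have hfin := expect_hitTime_ne_top hirr hpos
  obtain ⟨f, hf⟩ := exists_potential hirr hpos hrev
  have hpow : (16 : ℝ) ≤ 2 ^ n := by
    calc (16 : ℝ) = 2 ^ 4 := by norm_num
      _ ≤ 2 ^ n := pow_le_pow_right₀ (by norm_num) hn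
  have hdisj : ∀ k l, k ≠ l → Disjoint (H k) (H l) := by
    intro k l hkl
    refine Set.disjoint_left.2 fun y hk hl => ?_
    have h1 := hball k y hk
    have h2 := hball l y hl
    have h3 := commuteReal_triangle hfin (t k) y (t l)
    rw [commuteReal_comm κ (t k) y] at h3
    have h4 := hsep k l hkl
    linarith
  -- Starting points in the same cluster are at distance at most a/8, so the supremum in cov of the
  -- cluster is nearly reached from any of them.
  have hinner : ∀ l, ∀ y ∈ H l, ENNReal.ofReal (β - a / 8) ≤ expect κ y (coverTime (H l)) := by
    intro l y hy
    have hHfin : cov κ (H l) ≠ ∞ := ne_top_of_le_ne_top hA (cov_mono κ (hsub l))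
    have hyfin : expect κ y (coverTime (H l)) ≠ ∞ :=
      ne_top_of_le_ne_top hHfin (expect_le_cov κ hy)
    have h1 : cov κ (H l) ≤ ENNReal.ofReal (a / 8) + expect κ y (coverTime (H l)) := by
      refine iSup₂_le fun x hx => (expect_coverTime_le κ x y (H l)).trans (add_le_add ?_ le_rfl)
      rw [← ENNReal.ofReal_toReal (hfin x y)]
      refine ENNReal.ofReal_le_ofReal ?_
      have h2 := hball l x hx
      have h3 := hball l y hy
      have h4 := commuteReal_triangle hfin x (t l) y
      rw [commuteReal_comm κ (t l) y] at h4
      have h5 := hitReal_le_commuteReal κ x y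
      unfold hitReal at h5
      linarith
    have h2 := ENNReal.toReal_mono (ENNReal.add_ne_top.2 ⟨ENNReal.ofReal_ne_top, hyfin⟩) h1
    rw [ENNReal.toReal_add ENNReal.ofReal_ne_top hyfin, ENNReal.toReal_ofReal (by positivity)] at h2
    have h3 := hβ l
    exact ENNReal.ofReal_le_of_le_toReal (by linarith)
  have houter : ∀ l y, ENNReal.ofReal (hitReal κ y (t l) - a / 16) ≤ expect κ y (hitSet (H l)) := by
    intro l y
    have h1 := expect_hitTime_le_hitSet κ (H := H l) (b := ENNReal.ofReal (a / 16)) (z := t l)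
      (fun u hu => by
        rw [← ENNReal.ofReal_toReal (hfin u (t l))]
        exact ENNReal.ofReal_le_ofReal ((hitReal_le_commuteReal κ u (t l)).trans (hball l u hu))) y
    rw [ENNReal.ofReal_sub _ (by positivity)]
    unfold hitReal
    rw [ENNReal.ofReal_toReal (hfin y (t l))]
    exact tsub_le_iff_right.2 h1
  have hcover : ∀ (S : Finset (Fin (2 ^ 2 ^ n))) (k : Fin (2 ^ 2 ^ n)) (p : ℝ), S.Nonempty →
      ENNReal.ofReal p ≤ expect κ (t k) (clusterTime H S) →
      p + (β - a / 8) ≤ (cov κ A).toReal := by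
    intro S k p hS hp
    refine add_le_toReal_of_ofReal_add_le hA hp ?_
    refine (expect_clusterTime_add_le hS (fun k _ l _ => hdisj k l) (A := A) (fun l _ => hsub l)
      (fun l _ => ⟨t l, ht l⟩) (fun l _ => hinner l)).trans (expect_le_cov κ (hsub k (ht k)))
  by_cases hcase : ∃ k l, a * 2 ^ n ≤ f (t k) - f (t l)
  · obtain ⟨k, l, hkl⟩ := hcase
    have h1 := hcover {l} k (a * 2 ^ n - a / 16) (Finset.singleton_nonempty l) ?_
    · nlinarith
    · have h2 : clusterTime H {l} = hitSet (H l) := by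
        ext1 ω; simp [clusterTime]
      rw [h2]
      refine le_trans (ENNReal.ofReal_le_ofReal ?_) (houter l (t k))
      have h3 := hf (t k) (t l)
      have h4 := hitReal_nonneg κ (t l) (t k)
      linarith
  · push Not at hcase
    obtain ⟨S, hcard, hS⟩ := exists_large_almost_constant hn ha (fun k => f (t k)) hcase
    obtain ⟨k, hk⟩ : S.Nonempty := Finset.card_pos.1 (Nat.zero_lt_of_lt hcard)
    have hcard' : 2 ^ 2 ^ (n - 1) ≤ (S.erase k).card := by
      rw [Finset.card_erase_of_mem hk]; omega
    have hpos' : 0 < 2 ^ 2 ^ (n - 1) := by positivity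
    -- Here d(y, t_l) ≥ 15a/16 and f(y) - f(t_l) ≥ -a/16 - a/4, so h(y, t_l) ≥ 5a/16; passing from
    -- the centre to the cluster costs a/16.
    have hgap : ∀ l ∈ S, ∀ i ∈ S, i ≠ l → ∀ y ∈ H i,
        ENNReal.ofReal (a / 4) ≤ expect κ y (hitSet (H l)) := by
      intro l hl i hi hil y hy
      refine le_trans (ENNReal.ofReal_le_ofReal ?_) (houter l y)
      have h1 := hball i y hy
      have h2 := hsep i l hil
      have h3 := commuteReal_triangle hfin (t i) y (t l)
      rw [commuteReal_comm κ (t i) y] at h3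
      have h4 := hS l hl i hi
      have h5 := hf y (t i)
      have h6 := hf y (t l)
      have h7 := hitReal_nonneg κ y (t i)
      have h8 := hitReal_nonneg κ (t i) y
      unfold commuteReal at *
      linarith
    have h1 := hcover (S.erase k) k (a / 4 * harmonic (S.erase k).card)
      (Finset.card_pos.1 (by omega)) ?_
    · have h2 : (2 : ℝ) ^ n / 4 ≤ harmonic (S.erase k).card := by
        have h3 := half_le_harmonic_two_pow (2 ^ (n - 1))
        have h4 : (harmonic (2 ^ 2 ^ (n - 1)) : ℝ) ≤ harmonic (S.erase k).card := by
          exact_mod_cast harmonic_mono hcard'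
        have h5 : (2 : ℝ) ^ n = 2 * 2 ^ (n - 1) := by
          rw [← pow_succ']; congr 1; omega
        push_cast at h3
        linarith
      -- The gain is a·2^n/16 - a/8; since 2^n ≥ 16, the loss a/8 takes at most half of a·2^n/32.
      nlinarith
    · rw [ENNReal.ofReal_mul (by positivity)]
      refine matthews_le_expect_clusterTime (S.erase k) (fun k _ l _ => hdisj k l) ?_
      rintro l hl y (rfl | ⟨i, hi, hil, hy⟩)
      · exact hgap l (Finset.mem_of_mem_erase hl) k hk (Finset.ne_of_mem_erase hl).symm _ (ht k)
      · exact hgap l (Finset.mem_of_mem_erase hl) i (Finset.mem_of_mem_erase hi) hil y hy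

end Growth

/-! ### Talagrand's partitioning scheme -/

section Partitioning

/-- Talagrand's growth condition for a functional `F` on the subsets of a metric space. -/
def GrowthCondition {T : Type*} (d : T → T → ℝ) (F : Set T → ℝ) : Prop :=
  ∀ (n : ℕ), 4 ≤ n → ∀ (a β : ℝ), 0 < a →
    ∀ (t : Fin (2 ^ 2 ^ n) → T) (H : Fin (2 ^ 2 ^ n) → Set T), (∀ l, t l ∈ H l) →
    (∀ k l, k ≠ l → a ≤ d (t k) (t l)) → (∀ l, ∀ y ∈ H l, d y (t l) ≤ a / 16) →
    (∀ l, β ≤ F (H l)) → a * 2 ^ n / 32 + β ≤ F (⋃ l, H l)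

variable {T : Type*} {d : T → T → ℝ} {F : Set T → ℝ}

theorem exists_near_maximizer (hF : ∀ A B, A ⊆ B → F A ≤ F B) {ε : ℝ} (hε : 0 < ε) (b : ℝ)
    {R : Set T} (hR : R.Nonempty) :
    ∃ s ∈ R, ∀ y ∈ R, F {z | z ∈ R ∧ d z y ≤ b} ≤ F {z | z ∈ R ∧ d z s ≤ b} + ε := by
  set g : T → ℝ := fun y => F {z | z ∈ R ∧ d z y ≤ b} with hg
  have hbdd : BddAbove (g '' R) := ⟨F Set.univ, by
    rintro _ ⟨y, _, rfl⟩
    exact hF _ _ (Set.subset_univ _)⟩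
  obtain ⟨_, ⟨s, hs, rfl⟩, h⟩ := exists_lt_of_lt_csSup (hR.image g)
    (show sSup (g '' R) - ε < sSup (g '' R) by linarith)
  refine ⟨s, hs, fun y hy => ?_⟩
  have := le_csSup hbdd (Set.mem_image_of_mem g hy)
  simp only [hg] at *
  linarith

/-- One step of the partitioning scheme: every piece either is contained in a ball of radius `a`, or
has only small balls of radius `a / 16`. -/
theorem exists_decomposition (hsymm : ∀ x y, d x y = d y x) (hself : ∀ x, d x x = 0)
    (hF : ∀ A B, A ⊆ B → F A ≤ F B) (hgrow : GrowthCondition d F) {n : ℕ} (hn : 4 ≤ n) {a : ℝ}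
    (ha : 0 < a) (B : Set T) :
    ∃ idx : T → Fin (2 ^ 2 ^ n), ∀ i,
      (∃ s ∈ B, ∀ y ∈ B, idx y = i → d y s ≤ a) ∨
      (∀ s ∈ B, idx s = i →
        F {y | (y ∈ B ∧ idx y = i) ∧ d y s ≤ a / 16} ≤ F B - a * 2 ^ n / 64) := by
  classical
  set m := 2 ^ 2 ^ n
  have hmpos : 0 < m := by positivity
  rcases B.eq_empty_or_nonempty with hB | ⟨b₀, hb₀⟩
  · refine ⟨fun _ => ⟨0, hmpos⟩, fun i => Or.inr ?_⟩
    rw [hB]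
    exact fun s hs => hs.elim
  have hε : 0 < a * 2 ^ n / 64 := by positivity
  obtain ⟨sel, hsel⟩ : ∃ sel : Set T → T, ∀ R : Set T, R.Nonempty → sel R ∈ R ∧ ∀ y ∈ R,
      F {z | z ∈ R ∧ d z y ≤ a / 16} ≤ F {z | z ∈ R ∧ d z (sel R) ≤ a / 16} + a * 2 ^ n / 64 := by
    have h : ∀ R : Set T, ∃ s, R.Nonempty → s ∈ R ∧ ∀ y ∈ R,
        F {z | z ∈ R ∧ d z y ≤ a / 16} ≤ F {z | z ∈ R ∧ d z s ≤ a / 16} + a * 2 ^ n / 64 := by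
      intro R
      by_cases hR : R.Nonempty
      · obtain ⟨s, hs, h⟩ := exists_near_maximizer (d := d) hF hε (a / 16) hR
        exact ⟨s, fun _ => ⟨hs, h⟩⟩
      · exact ⟨b₀, fun h => absurd h hR⟩
    choose sel hsel using h
    exact ⟨sel, hsel⟩
  -- Greedy removal: each step deletes from the remaining set the ball of radius `a` around a centre
  -- whose ball of radius a/16 nearly maximizes F. After m - 1 balls, the remainder is the last
  -- piece.
  obtain ⟨R, hR0, hRs⟩ : ∃ R : ℕ → Set T, R 0 = B ∧
      ∀ l, R (l + 1) = {y | y ∈ R l ∧ a < d y (sel (R l))} :=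
    ⟨fun l => Nat.rec B (fun _ R => {y | y ∈ R ∧ a < d y (sel R)}) l, rfl, fun _ => rfl⟩
  have hanti : Antitone R := antitone_nat_of_succ_le fun l => by
    rw [hRs]; exact fun y hy => hy.1
  have hRB : ∀ l, R l ⊆ B := fun l => hR0 ▸ hanti (Nat.zero_le l)
  set idx : T → Fin m := fun y =>
    if h : ∃ l, l < m - 1 ∧ y ∉ R (l + 1) then
      ⟨Nat.find h, (Nat.find_spec h).1.trans_le (Nat.sub_le _ _)⟩
    else ⟨m - 1, Nat.sub_lt hmpos one_pos⟩ with hidx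
  have hlt : ∀ y ∈ B, (idx y).1 < m - 1 → y ∈ R (idx y).1 ∧ d y (sel (R (idx y).1)) ≤ a := by
    intro y hy hly
    by_cases h : ∃ l, l < m - 1 ∧ y ∉ R (l + 1)
    · have hval : (idx y).1 = Nat.find h := by simp only [hidx, dif_pos h]
      rw [hval]
      have hmem : y ∈ R (Nat.find h) := by
        rcases Nat.eq_zero_or_pos (Nat.find h) with h0 | h0
        · rw [h0, hR0]; exact hy
        · have h1 := Nat.find_min h (Nat.sub_lt h0 one_pos)
          have h2 := (Nat.find_spec h).1
          rw [Nat.sub_add_cancel (show 1 ≤ Nat.find h from h0)] at h1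
          by_contra h3
          exact h1 ⟨by omega, h3⟩
      refine ⟨hmem, ?_⟩
      have h1 := (Nat.find_spec h).2
      rw [hRs] at h1
      by_contra h2
      exact h1 ⟨hmem, not_le.1 h2⟩
    · simp only [hidx, dif_neg h] at hly
      omega
  have hge : ∀ y ∈ B, ¬ (idx y).1 < m - 1 → y ∈ R (m - 1) := by
    intro y hy hly
    by_cases h : ∃ l, l < m - 1 ∧ y ∉ R (l + 1)
    · simp only [hidx, dif_pos h] at hly
      exact absurd (Nat.find_spec h).1 hly
    · push Not at h
      rcases Nat.eq_zero_or_pos (m - 1) with h0 | h0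
      · rw [h0, hR0]; exact hy
      · have := h (m - 1 - 1) (by omega)
        rwa [Nat.sub_add_cancel (show 1 ≤ m - 1 from h0)] at this
  refine ⟨idx, fun i => ?_⟩
  by_cases hi : i.1 < m - 1
  · by_cases hex : ∃ y ∈ B, idx y = i
    · obtain ⟨y, hy, rfl⟩ := hex
      have hne : (R (idx y).1).Nonempty := ⟨y, (hlt y hy hi).1⟩
      refine Or.inl ⟨sel (R (idx y).1), hRB _ (hsel _ hne).1, fun z hz hzy => ?_⟩
      have := (hlt z hz (by rw [hzy]; exact hi)).2
      rwa [hzy] at this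
    · push Not at hex
      exact Or.inr fun s hs h => absurd h (hex s hs)
  · refine Or.inr fun s hs hsi => ?_
    have hsR : s ∈ R (m - 1) := hge s hs (by rw [hsi]; exact hi)
    have hsR' : ∀ l : Fin m, s ∈ R l := fun l => hanti (by have := l.2; omega) hsR
    set t : Fin m → T := fun l => if l.1 < m - 1 then sel (R l) else s with ht
    have htR : ∀ l : Fin m, t l ∈ R l := by
      intro l
      by_cases hl : l.1 < m - 1
      · simp only [ht, if_pos hl]
        exact (hsel _ ⟨s, hsR' l⟩).1
      · simp only [ht, if_neg hl]
        exact hsR' l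
    have hsep : ∀ k l : Fin m, k < l → a ≤ d (t k) (t l) := by
      intro k l hkl
      have hk : k.1 < m - 1 := by have := l.2; have : k.1 < l.1 := hkl; omega
      have h1 : t l ∈ R (k.1 + 1) := hanti (Nat.succ_le_of_lt hkl) (htR l)
      rw [hRs] at h1
      have h2 : t k = sel (R k) := by simp only [ht, if_pos hk]
      rw [h2, hsymm]
      exact h1.2.le
    -- Growth is applied to the m - 1 selected centres and `s`. Since `s` survived every removal,
    -- near-maximality bounds F on each selected small ball below by its value around `s`, up to
    -- a·2^n/64: half of the growth gain a·2^n/32 remains.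
    have key := hgrow n hn a
      (F {y | (y ∈ B ∧ idx y = i) ∧ d y s ≤ a / 16} - a * 2 ^ n / 64) ha t
      (fun l => {z | z ∈ R l ∧ d z (t l) ≤ a / 16})
      (fun l => ⟨htR l, by rw [hself]; positivity⟩) ?_ (fun l y hy => hy.2) ?_
    · have h1 := hF (⋃ l : Fin m, {z | z ∈ R l ∧ d z (t l) ≤ a / 16}) B
        (Set.iUnion_subset fun l z hz => hRB _ hz.1)
      linarith
    · intro k l hkl
      rcases lt_or_gt_of_ne hkl with h | h
      · exact hsep k l h
      · rw [hsymm]; exact hsep l k h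
    · intro l
      have h1 : F {y | (y ∈ B ∧ idx y = i) ∧ d y s ≤ a / 16} ≤
          F {z | z ∈ R l ∧ d z s ≤ a / 16} := by
        refine hF _ _ fun y hy => ⟨?_, hy.2⟩
        refine hanti ?_ (hge y hy.1.1 (by rw [hy.1.2]; exact hi))
        have := l.2; omega
      by_cases hl : l.1 < m - 1
      · have h2 := (hsel _ ⟨s, hsR' l⟩).2 s (hsR' l)
        have h3 : t l = sel (R l) := by simp only [ht, if_pos hl]
        rw [h3]
        linarith
      · have h3 : t l = s := by simp only [ht, if_neg hl]
        rw [h3]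
        linarith

/-- A cell of the partitioning scheme, with a radius and bounds for the functional `F` on it and on
its balls of two smaller radii. -/
structure Cell (T : Type*) where
  carrier : Set T
  radius : ℝ
  bound₀ : ℝ
  bound₁ : ℝ
  bound₂ : ℝ
  gain : ℝ

namespace Cell

/-- The weight of a cell at level `n`. -/
def weight (n : ℕ) (s : Cell T) : ℝ := 2 ^ n * s.radius / 16

/-- The potential of a cell at level `n`; it drops by at least the weight at each step. -/
def potential (n : ℕ) (s : Cell T) : ℝ :=
  384 * (s.bound₀ + s.bound₁) - 6 * s.gain + 2 * s.weight n

/-- The invariants of the partitioning scheme. -/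
structure IsGood (d : T → T → ℝ) (F : Set T → ℝ) (n : ℕ) (s : Cell T) : Prop where
  radius_pos : 0 < s.radius
  le_bound₀ : F s.carrier ≤ s.bound₀
  le_bound₁ : ∀ t ∈ s.carrier, F {y | y ∈ s.carrier ∧ d y t ≤ s.radius / 16} ≤ s.bound₁
  le_bound₂ : ∀ t ∈ s.carrier, F {y | y ∈ s.carrier ∧ d y t ≤ s.radius / 256} ≤ s.bound₂
  dist_le : ∀ y ∈ s.carrier, ∀ z ∈ s.carrier, d y z ≤ 2 * s.radius
  bound₂_le : s.bound₂ ≤ s.bound₁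
  gain_le : s.gain / 64 ≤ s.bound₀ - s.bound₂
  gain_eq : s.gain = 0 ∨ s.gain = s.weight n / 2

theorem IsGood.weight_pos {n : ℕ} {s : Cell T} (h : s.IsGood d F n) : 0 < s.weight n := by
  have := h.radius_pos
  unfold weight
  positivity

/-- The gain is paid for by the bounds: 6·gain ≤ 384·(b₀ - b₂), because 384 = 6·64. -/
theorem IsGood.potential_nonneg (hF0 : ∀ A, 0 ≤ F A) {n : ℕ} {s : Cell T} (h : s.IsGood d F n)
    (hs : s.carrier.Nonempty) : 0 ≤ s.potential n := by
  obtain ⟨t, ht⟩ := hs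
  have h1 := h.weight_pos
  have h2 := (hF0 _).trans (h.le_bound₁ t ht)
  have h3 := (hF0 _).trans (h.le_bound₂ t ht)
  have h4 := h.gain_le
  unfold potential
  linarith

theorem IsGood.exists_step (hsymm : ∀ x y, d x y = d y x) (hself : ∀ x, d x x = 0)
    (htri : ∀ x y z, d x z ≤ d x y + d y z)
    (hF : ∀ A B, A ⊆ B → F A ≤ F B) (hgrow : GrowthCondition d F) {n : ℕ} (hn : 4 ≤ n)
    {s : Cell T} (h : s.IsGood d F n) :
    ∃ (idx : T → Fin (2 ^ 2 ^ n)) (next : Fin (2 ^ 2 ^ n) → Cell T), ∀ i,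
      (next i).IsGood d F (n + 1) ∧ (next i).carrier = {y | y ∈ s.carrier ∧ idx y = i} ∧
      (next i).potential (n + 1) + s.weight n ≤ s.potential n := by
  have hρ := h.radius_pos
  have hw := h.weight_pos
  obtain ⟨idx, hidx⟩ := exists_decomposition hsymm hself hF hgrow hn
    (a := s.radius / 16) (by positivity) s.carrier
  have hex : ∀ i, ∃ s' : Cell T, s'.IsGood d F (n + 1) ∧
      s'.carrier = {y | y ∈ s.carrier ∧ idx y = i} ∧
      s'.potential (n + 1) + s.weight n ≤ s.potential n := by
    intro i
    rcases hidx i with ⟨c, hc, hball⟩ | hrem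
    -- Ball piece: the radius drops by 16 and the three bounds move down one place. With w the
    -- weight, 384·(b₀ - b₂) absorbs 6·gain, while 2w becomes w/4; the drop is at least 7w/4.
    · refine ⟨⟨{y | y ∈ s.carrier ∧ idx y = i}, s.radius / 16, s.bound₁, s.bound₂, s.bound₂, 0⟩,
        ⟨?_, ?_, ?_, ?_, ?_, le_rfl, ?_, Or.inl rfl⟩, rfl, ?_⟩
      · exact div_pos hρ (by norm_num)
      · refine le_trans (hF _ _ ?_) (h.le_bound₁ c hc)
        exact fun y hy => ⟨hy.1, hball y hy.1 hy.2⟩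
      · intro t ht
        refine le_trans (hF _ _ ?_) (h.le_bound₂ t ht.1)
        refine fun y hy => ⟨hy.1.1, ?_⟩
        have := hy.2
        simp only at this
        linarith
      · intro t ht
        refine le_trans (hF _ _ ?_) (h.le_bound₂ t ht.1)
        refine fun y hy => ⟨hy.1.1, ?_⟩
        have := hy.2
        simp only at this
        linarith
      · intro y hy z hz
        have h1 := htri y c z
        have h2 := hball y hy.1 hy.2
        have h3 := hball z hz.1 hz.2
        rw [hsymm c z] at h1
        simp only
        linarith
      · have := h.bound₂_le
        simp only
        linarith
      · have h1 := h.gain_le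
        simp only [potential, weight, pow_succ] at hw ⊢
        linarith
    -- Remainder piece: the radius is kept, so the weight doubles, and the drop of F on small balls
    -- is recorded as gain w. The potential loses 6w - 6·gain - 2w, at least w since the old gain is
    -- at most w/2.
    · refine ⟨⟨{y | y ∈ s.carrier ∧ idx y = i}, s.radius, s.bound₀, s.bound₁,
        min s.bound₂ (s.bound₀ - s.weight n / 64), s.weight n⟩,
        ⟨hρ, ?_, ?_, ?_, ?_, ?_, ?_, Or.inr ?_⟩, rfl, ?_⟩
      · exact (hF _ _ fun y hy => hy.1).trans h.le_bound₀
      · intro t ht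
        refine le_trans (hF _ _ ?_) (h.le_bound₁ t ht.1)
        exact fun y hy => ⟨hy.1.1, hy.2⟩
      · intro t ht
        refine le_min (le_trans (hF _ _ ?_) (h.le_bound₂ t ht.1)) ?_
        · exact fun y hy => ⟨hy.1.1, hy.2⟩
        have h1 := hrem t ht.1 ht.2
        have h2 := h.le_bound₀
        have h3 : s.radius / 16 / 16 = s.radius / 256 := by ring
        have h4 : s.radius / 16 * 2 ^ n = s.weight n := by unfold weight; ring
        rw [h3, h4] at h1
        exact h1.trans (by linarith)
      · intro y hy z hz
        exact h.dist_le y hy.1 z hz.1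
      · exact (min_le_left _ _).trans h.bound₂_le
      · have := min_le_right s.bound₂ (s.bound₀ - s.weight n / 64)
        simp only
        linarith
      · simp only [weight, pow_succ]
        ring
      · have h1 : s.gain ≤ s.weight n / 2 := by
          rcases h.gain_eq with h2 | h2 <;> rw [h2]
          linarith
        simp only [potential, weight, pow_succ] at h1 hw ⊢
        linarith
  choose next hnext using hex
  exact ⟨idx, next, hnext⟩

end Cell

/-- The exponents form a geometric sum: 2^4 + … + 2^(m+3) ≤ 2^(m+4). -/
theorem prod_two_pow_le (m : ℕ) : ∏ k : Fin m, 2 ^ 2 ^ (k.1 + 4) ≤ 2 ^ 2 ^ (m + 4) := by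
  rw [Fin.prod_univ_eq_prod_range (fun k => 2 ^ 2 ^ (k + 4)) m]
  induction m with
  | zero => simp
  | succ m ih =>
    rw [Finset.prod_range_succ]
    refine (Nat.mul_le_mul_right _ ih).trans (le_of_eq ?_)
    rw [← pow_add]
    congr 1
    ring

theorem prod_le_admissibleCard (n : ℕ) :
    ∏ k : Fin (n - 4), 2 ^ 2 ^ (k.1 + 4) ≤ admissibleCard n := by
  rcases Nat.lt_or_ge n 4 with hn | hn
  · rw [Nat.sub_eq_zero_of_le hn.le, Fin.prod_univ_zero, admissibleCard]
    split_ifs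
    · exact le_rfl
    · exact Nat.one_le_two_pow
  · obtain ⟨m, rfl⟩ := Nat.exists_eq_add_of_le' hn
    rw [Nat.add_sub_cancel, admissibleCard, if_neg (by omega)]
    exact prod_two_pow_le m

theorem encard_classes_ker_le {α β : Type*} [Fintype β] (f : α → β) :
    (Setoid.ker f).classes.encard ≤ Fintype.card β := by
  have h : (Setoid.ker f).classes ⊆ (fun b => {x | f x = b}) '' (Set.univ : Set β) := by
    rintro _ ⟨y, rfl⟩
    exact ⟨f y, trivial, rfl⟩
  refine (Set.encard_le_encard h).trans ((Set.encard_image_le _ _).trans (le_of_eq ?_))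
  rw [Set.encard_univ, ENat.card_eq_coe_fintype_card]

/-- The partitioning theorem for functionals satisfying the growth condition. -/
theorem exists_admissible (hsymm : ∀ x y, d x y = d y x) (hself : ∀ x, d x x = 0)
    (htri : ∀ x y z, d x z ≤ d x y + d y z) (hF0 : ∀ A, 0 ≤ F A)
    (hF : ∀ A B, A ⊆ B → F A ≤ F B) (hgrow : GrowthCondition d F) {r : ℝ} (hr : 0 < r)
    (hdiam : ∀ x y, d x y ≤ r) :
    ∃ (𝒜 : ℕ → Setoid T) (D : ℕ → T → ℝ), IsAdmissible 𝒜 ∧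
      (∀ n x y z, 𝒜 n y x → 𝒜 n z x → d y z ≤ D n x) ∧ (∀ n x, 0 ≤ D n x) ∧
      ∀ N x, ∑ n ∈ Finset.range N, 2 ^ n * D n x ≤ 24576 * F Set.univ + 79 * r := by
  have hstep : ∀ (m : ℕ) (s : Cell T), ∃ (idx : T → Fin (2 ^ 2 ^ (m + 4)))
      (next : Fin (2 ^ 2 ^ (m + 4)) → Cell T), s.IsGood d F (m + 4) → ∀ i,
      (next i).IsGood d F (m + 4 + 1) ∧ (next i).carrier = {y | y ∈ s.carrier ∧ idx y = i} ∧
      (next i).potential (m + 4 + 1) + s.weight (m + 4) ≤ s.potential (m + 4) := by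
    intro m s
    by_cases hs : s.IsGood d F (m + 4)
    · obtain ⟨idx, next, h⟩ := hs.exists_step hsymm hself htri hF hgrow (Nat.le_add_left 4 m)
      exact ⟨idx, next, fun _ => h⟩
    · exact ⟨fun _ => ⟨0, by positivity⟩, fun _ => s, fun h => absurd h hs⟩
  choose idx next hnext using hstep
  set s₀ : Cell T := ⟨Set.univ, r, F Set.univ, F Set.univ, F Set.univ, 0⟩ with hs₀
  have hs₀good : s₀.IsGood d F 4 := by
    refine ⟨hr, le_rfl, ?_, ?_, ?_, le_rfl, ?_, Or.inl rfl⟩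
    · exact fun _ _ => hF _ _ (Set.subset_univ _)
    · exact fun _ _ => hF _ _ (Set.subset_univ _)
    · intro y _ z _
      have := hdiam y z
      simp only [hs₀]
      linarith
    · simp [hs₀]
  obtain ⟨st, hst0, hsts⟩ : ∃ st : ℕ → T → Cell T, (∀ x, st 0 x = s₀) ∧
      ∀ m x, st (m + 1) x = next m (st m x) (idx m (st m x) x) :=
    ⟨fun m x => Nat.rec s₀ (fun m s => next m s (idx m s x)) m, fun _ => rfl, fun _ _ => rfl⟩
  have hgood : ∀ m x, (st m x).IsGood d F (m + 4) ∧ x ∈ (st m x).carrier := by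
    intro m x
    induction m with
    | zero => rw [hst0]; exact ⟨hs₀good, trivial⟩
    | succ m ih =>
      have h := hnext m (st m x) ih.1 (idx m (st m x) x)
      rw [hsts]
      refine ⟨by have := h.1; rwa [show m + 1 + 4 = m + 4 + 1 by ring], ?_⟩
      rw [h.2.1]
      exact ⟨ih.2, rfl⟩
  have hpot : ∀ m x, ∑ k ∈ Finset.range m, (st k x).weight (k + 4) +
      (st m x).potential (m + 4) ≤ s₀.potential 4 := by
    intro m x
    induction m with
    | zero => simp [hst0]
    | succ m ih =>
      have h := (hnext m (st m x) (hgood m x).1 (idx m (st m x) x)).2.2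
      rw [Finset.sum_range_succ, hsts, show m + 1 + 4 = m + 4 + 1 by ring]
      linarith
  -- The cell at level `n` is labelled by all choices made at levels 4, …, n - 1. This makes
  -- refinement automatic and gives the trivial partition up to level 4.
  set code : ∀ n : ℕ, T → (∀ k : Fin (n - 4), Fin (2 ^ 2 ^ (k.1 + 4))) :=
    fun n x k => idx k (st k x) x with hcode
  have hsteq : ∀ m x y, (∀ k < m, idx k (st k y) y = idx k (st k x) x) → st m y = st m x := by
    intro m x y
    induction m with
    | zero => intro _; rw [hst0, hst0]
    | succ m ih =>
      intro h
      have h1 := h m (Nat.lt_succ_self m)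
      rw [hsts, hsts, h1, ih fun k hk => h k (hk.trans (Nat.lt_succ_self m))]
  have hcell : ∀ m x y, code (m + 4) y = code (m + 4) x → y ∈ (st m x).carrier := by
    intro m x y h
    rw [← hsteq m x y fun k hk => congrFun h ⟨k, by omega⟩]
    exact (hgood m y).2
  refine ⟨fun n => Setoid.ker (code n), fun n x => if n < 4 then r else 2 * (st (n - 4) x).radius,
    ⟨?_, ?_⟩, ?_, ?_, ?_⟩
  · intro n x y h
    refine funext fun k => ?_
    exact congrFun (show code (n + 1) x = code (n + 1) y from h) ⟨k.1, by have := k.2; omega⟩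
  · intro n
    refine (encard_classes_ker_le (code n)).trans ?_
    rw [Fintype.card_pi]
    simp only [Fintype.card_fin]
    exact_mod_cast prod_le_admissibleCard n
  · intro n x y z hy hz
    by_cases hn : n < 4
    · simp only [if_pos hn]; exact hdiam y z
    · obtain ⟨m, rfl⟩ := Nat.exists_eq_add_of_le' (not_lt.1 hn)
      simp only [if_neg hn, Nat.add_sub_cancel]
      exact (hgood m x).1.dist_le y (hcell m x y hy) z (hcell m x z hz)
  · intro n x
    by_cases hn : n < 4
    · simp only [if_pos hn]; exact hr.le
    · simp only [if_neg hn]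
      have := (hgood (n - 4) x).1.radius_pos
      positivity
  · intro N x
    have hnn : ∀ n, 0 ≤ 2 ^ n * (if n < 4 then r else 2 * (st (n - 4) x).radius) := by
      intro n
      have := (hgood (n - 4) x).1.radius_pos
      split_ifs <;> positivity
    -- Levels below 4 contribute (1+2+4+8)·r = 15r. Each later term is 32 weights, and the weights
    -- sum to at most the initial potential 768·F + 2r; in total 24576·F + 79r.
    refine (Finset.sum_le_sum_of_subset_of_nonneg
      (Finset.range_mono (Nat.le_add_left N 4)) fun n _ _ => hnn n).trans ?_
    rw [Finset.sum_range_add]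
    have h1 : ∑ n ∈ Finset.range 4, 2 ^ n * (if n < 4 then r else 2 * (st (n - 4) x).radius) =
        15 * r := by
      simp [Finset.sum_range_succ]
      ring
    have h2 : ∑ n ∈ Finset.range N,
        2 ^ (4 + n) * (if 4 + n < 4 then r else 2 * (st (4 + n - 4) x).radius) =
        32 * ∑ n ∈ Finset.range N, (st n x).weight (n + 4) := by
      rw [Finset.mul_sum]
      refine Finset.sum_congr rfl fun n _ => ?_
      rw [if_neg (by omega), Nat.add_sub_cancel_left, Cell.weight, add_comm 4 n]
      ring
    have h3 := hpot N x
    have h4 := (hgood N x).1.potential_nonneg hF0 ⟨x, (hgood N x).2⟩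
    have h5 : s₀.potential 4 = 768 * F Set.univ + 2 * r := by
      simp only [Cell.potential, Cell.weight, hs₀]
      ring
    rw [h1, h2]
    linarith

end Partitioning

/-! ### Comparing γ₁ for d with γ₂ for √d -/

section Chaining

theorem chainingFunctional_one_le {T : Type*} {d : T → T → ℝ} {𝒜 : ℕ → Setoid T}
    (h𝒜 : IsAdmissible 𝒜) {D : ℕ → T → ℝ} {K : ℝ}
    (hD : ∀ n x y z, 𝒜 n y x → 𝒜 n z x → d y z ≤ D n x) (hD0 : ∀ n x, 0 ≤ D n x)
    (hK : ∀ N x, ∑ n ∈ Finset.range N, 2 ^ n * D n x ≤ K) :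
    chainingFunctional 1 T (fun x y => ENNReal.ofReal (d x y)) ≤ ENNReal.ofReal K := by
  refine (iInf₂_le 𝒜 h𝒜).trans (iSup_le fun x => ENNReal.tsum_le_of_sum_range_le fun N => ?_)
  refine le_trans ?_ (ENNReal.ofReal_le_ofReal (hK N x))
  rw [ENNReal.ofReal_sum_of_nonneg fun n _ => mul_nonneg (by positivity) (hD0 n x)]
  refine Finset.sum_le_sum fun n _ => ?_
  rw [ENNReal.ofReal_mul (by positivity), div_one, ENNReal.rpow_natCast,
    ENNReal.ofReal_pow (by norm_num), ENNReal.ofReal_ofNat]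
  exact mul_le_mul' le_rfl
    (iSup₂_le fun y hy => iSup₂_le fun z hz => ENNReal.ofReal_le_ofReal (hD n x y z hy hz))

theorem tsum_sq_le_sq_tsum (u : ℕ → ℝ≥0∞) : ∑' n, u n ^ 2 ≤ (∑' n, u n) ^ 2 := by
  rw [sq (∑' n, u n), ← ENNReal.tsum_mul_left]
  refine ENNReal.tsum_le_tsum fun n => ?_
  rw [sq]
  exact mul_le_mul' (ENNReal.le_tsum n) le_rfl

theorem rpow_half_sq (a : ℝ≥0∞) : (a ^ (1 / 2 : ℝ)) ^ 2 = a := by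
  rw [← ENNReal.rpow_natCast, ← ENNReal.rpow_mul]
  norm_num

theorem sq_le_iff_le_rpow_half {a b : ℝ≥0∞} : a ^ 2 ≤ b ↔ a ≤ b ^ (1 / 2 : ℝ) := by
  rw [← ENNReal.pow_le_pow_left_iff (n := 2) (by norm_num) (a := a), rpow_half_sq]

theorem le_sq_iff_rpow_half_le {a b : ℝ≥0∞} : a ≤ b ^ 2 ↔ a ^ (1 / 2 : ℝ) ≤ b := by
  rw [← ENNReal.pow_le_pow_left_iff (n := 2) (by norm_num) (b := b), rpow_half_sq]

theorem two_rpow_half_sq (n : ℕ) : ((2 : ℝ≥0∞) ^ ((n : ℝ) / 2)) ^ 2 = 2 ^ n := by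
  rw [← ENNReal.rpow_natCast, ← ENNReal.rpow_mul, ← ENNReal.rpow_natCast]
  norm_num

variable {S : Type*}

theorem diam_le_sq_diam_sqrt (d : S → S → ℝ≥0∞) (B : Set S) :
    diam d B ≤ diam (fun x y => d x y ^ (1 / 2 : ℝ)) B ^ 2 := by
  refine iSup₂_le fun x hx => iSup₂_le fun y hy => ?_
  rw [le_sq_iff_rpow_half_le]
  exact le_iSup₂_of_le x hx (le_iSup₂_of_le (f := fun y (_ : y ∈ B) => d x y ^ (1 / 2 : ℝ)) y hy
    le_rfl)

theorem sq_diam_sqrt_le_diam (d : S → S → ℝ≥0∞) (B : Set S) :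
    diam (fun x y => d x y ^ (1 / 2 : ℝ)) B ^ 2 ≤ diam d B := by
  rw [sq_le_iff_le_rpow_half]
  refine iSup₂_le fun x hx => iSup₂_le fun y hy => ENNReal.rpow_le_rpow ?_ (by norm_num)
  exact le_iSup₂_of_le x hx (le_iSup₂_of_le (f := fun y (_ : y ∈ B) => d x y) y hy le_rfl)

theorem chainingFunctional_one_le_sq (d : S → S → ℝ≥0∞) :
    chainingFunctional 1 S d ≤ chainingFunctional 2 S (fun x y => d x y ^ (1 / 2 : ℝ)) ^ 2 := by
  rw [le_sq_iff_rpow_half_le]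
  refine le_iInf₂ fun 𝒜 h𝒜 => ?_
  rw [← le_sq_iff_rpow_half_le]
  refine (iInf₂_le 𝒜 h𝒜).trans (iSup_le fun x => ?_)
  calc ∑' n : ℕ, (2 : ℝ≥0∞) ^ ((n : ℝ) / 1) * diam d {y | (𝒜 n) y x}
      ≤ ∑' n : ℕ, ((2 : ℝ≥0∞) ^ ((n : ℝ) / 2) *
          diam (fun x y => d x y ^ (1 / 2 : ℝ)) {y | (𝒜 n) y x}) ^ 2 := by
        refine ENNReal.tsum_le_tsum fun n => ?_
        rw [mul_pow, two_rpow_half_sq, div_one, ENNReal.rpow_natCast]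
        exact mul_le_mul' le_rfl (diam_le_sq_diam_sqrt d _)
    _ ≤ _ := tsum_sq_le_sq_tsum _
    _ ≤ _ := pow_le_pow_left' (le_iSup (fun x => ∑' n : ℕ, (2 : ℝ≥0∞) ^ ((n : ℝ) / 2) *
          diam (fun x y => d x y ^ (1 / 2 : ℝ)) {y | (𝒜 n) y x}) x) 2

theorem sq_sum_range_le (u : ℕ → ℝ≥0∞) (k : ℕ) :
    (∑ n ∈ Finset.range k, u n) ^ 2 ≤ k * ∑ n ∈ Finset.range k, u n ^ 2 := by
  have h := ENNReal.rpow_sum_le_const_mul_sum_rpow (Finset.range k) u (p := 2) (by norm_num)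
  norm_num at h
  exact h

/-- An admissible sequence may be replaced by the partition into points from scale `k` on. Only `k`
terms survive, and Cauchy–Schwarz on them costs the factor `k`. -/
theorem sq_chainingFunctional_two_le [Fintype S] (d : S → S → ℝ≥0∞) (hd : ∀ x, d x x = 0) {k : ℕ}
    (hk : 1 ≤ k) (hcard : Fintype.card S ≤ 2 ^ 2 ^ k) :
    chainingFunctional 2 S (fun x y => d x y ^ (1 / 2 : ℝ)) ^ 2 ≤
      k * chainingFunctional 1 S d := by
  have hk0 : (k : ℝ≥0∞) ≠ 0 := by exact_mod_cast (by omega : k ≠ 0)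
  rw [← ENNReal.div_le_iff' hk0 (ENNReal.natCast_ne_top k)]
  refine le_iInf₂ fun 𝒜 h𝒜 => ?_
  rw [ENNReal.div_le_iff' hk0 (ENNReal.natCast_ne_top k)]
  set ℬ : ℕ → Setoid S := fun n => if n < k then 𝒜 n else Setoid.ker id
  have hℬadm : IsAdmissible ℬ := by
    constructor
    · intro n
      change (if n + 1 < k then 𝒜 (n + 1) else Setoid.ker id) ≤
        if n < k then 𝒜 n else Setoid.ker id
      by_cases h1 : n + 1 < k
      · rw [if_pos h1, if_pos (by omega)]
        exact h𝒜.refines n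
      · rw [if_neg h1]
        intro x y hxy
        have hxy' : x = y := hxy
        rw [hxy']
    · intro n
      change (if n < k then 𝒜 n else Setoid.ker id).classes.encard ≤ _
      by_cases h1 : n < k
      · rw [if_pos h1]; exact h𝒜.card_le n
      · rw [if_neg h1]
        refine (encard_classes_ker_le id).trans ?_
        rw [admissibleCard, if_neg (by omega)]
        exact_mod_cast hcard.trans (Nat.pow_le_pow_right (by norm_num)
          (Nat.pow_le_pow_right (by norm_num) (by omega)))
  rw [sq_le_iff_le_rpow_half]
  refine (iInf₂_le ℬ hℬadm).trans (iSup_le fun x => ?_)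
  rw [← sq_le_iff_le_rpow_half, tsum_eq_sum (s := Finset.range k)]
  · refine (sq_sum_range_le _ k).trans (mul_le_mul' le_rfl ?_)
    refine le_trans ?_ (le_iSup (fun x => ∑' n : ℕ, (2 : ℝ≥0∞) ^ ((n : ℝ) / 1) *
      diam d {y | (𝒜 n) y x}) x)
    refine le_trans (Finset.sum_le_sum fun n hn => ?_) (ENNReal.sum_le_tsum (Finset.range k))
    rw [mul_pow, two_rpow_half_sq, div_one, ENNReal.rpow_natCast]
    have hℬn : ℬ n = 𝒜 n := if_pos (Finset.mem_range.1 hn)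
    rw [hℬn]
    exact mul_le_mul' le_rfl (sq_diam_sqrt_le_diam d _)
  · intro n hn
    have hn' : ¬ n < k := fun h => hn (Finset.mem_range.2 h)
    have : diam (fun x y => d x y ^ (1 / 2 : ℝ)) {y | (ℬ n) y x} = 0 := by
      refine le_antisymm (iSup₂_le fun y hy => iSup₂_le fun z hz => ?_) zero_le
      have hℬn : ℬ n = Setoid.ker id := if_neg hn'
      rw [hℬn] at hy hz
      have hy' : y = x := hy
      have hz' : z = x := hz
      simp [hy', hz', hd]
    rw [this, mul_zero]

theorem log_log_three_pos : 0 < Real.log (Real.log 3) := by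
  refine Real.log_pos ?_
  rw [Real.lt_log_iff_exp_lt (by norm_num)]
  exact Real.exp_one_lt_d9.trans (by norm_num)

/-- The first scale at which the partition into points is allowed is of order `log log N`. -/
theorem exists_scale_le_log_log {N : ℕ} (hN : 3 ≤ N) :
    ∃ k : ℕ, 1 ≤ k ∧ N ≤ 2 ^ 2 ^ k ∧
      (k : ℝ) ≤ (2 + 2 / Real.log (Real.log 3)) * Real.log (Real.log N) := by
  have hex : ∃ k, N ≤ 2 ^ 2 ^ k :=
    ⟨N, (Nat.lt_two_pow_self.trans (Nat.pow_lt_pow_right (by norm_num) Nat.lt_two_pow_self)).le⟩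
  have hc := log_log_three_pos
  set c := Real.log (Real.log 3)
  have hN' : (3 : ℝ) ≤ N := by exact_mod_cast hN
  have hlog3 : 0 < Real.log 3 := Real.log_pos (by norm_num)
  have hy : c ≤ Real.log (Real.log N) :=
    Real.log_le_log hlog3 (Real.log_le_log (by norm_num) hN')
  set y := Real.log (Real.log N) with hydef
  have hratio : 1 ≤ y / c := by rwa [one_le_div hc]
  have hexp : (2 + 2 / c) * y = 2 * y + 2 * (y / c) := by ring
  rw [hexp]
  set k := Nat.find hex
  have hspec : N ≤ 2 ^ 2 ^ k := Nat.find_spec hex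
  have hk1 : 1 ≤ k := by
    by_contra h
    have h0 : k = 0 := by omega
    rw [h0] at hspec
    norm_num at hspec
    omega
  refine ⟨k, hk1, hspec, ?_⟩
  rcases Nat.eq_or_lt_of_le hk1 with h | h
  · rw [← h]
    push_cast
    linarith
  · have h1 : 2 ^ 2 ^ (k - 1) < N := not_le.1 (Nat.find_min hex (by omega : k - 1 < k))
    have h2 : ((2 : ℝ) ^ (2 ^ (k - 1) : ℕ)) ≤ N := by exact_mod_cast h1.le
    have h3 := Real.log_le_log (by positivity) h2
    rw [Real.log_pow] at h3
    have hl2 := Real.log_two_gt_d9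
    push_cast at h3
    have h4 := Real.log_le_log (by positivity) h3
    rw [Real.log_mul (by positivity) (by positivity), Real.log_pow,
      Nat.cast_sub hk1, Nat.cast_one, ← hydef] at h4
    -- Minimality of `k` gives (k - 1)·log 2 + log log 2 ≤ log log N. The additive constants are
    -- absorbed by the 2/log log 3 term, as log log N ≥ log log 3.
    have h5 : -(1 / 2) ≤ Real.log (Real.log 2) := by
      refine le_trans ?_ (Real.one_sub_inv_le_log_of_pos (by linarith))
      have : (Real.log 2)⁻¹ ≤ 3 / 2 := by
        rw [inv_le_comm₀ (by linarith) (by norm_num)]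
        linarith
      linarith
    have hk2 : (2 : ℝ) ≤ k := by exact_mod_cast h
    nlinarith

end Chaining

/-! ### Assembling the two bounds -/

section Main

variable {M : Type*} [Countable M] [MeasurableSpace M] [DiscreteMeasurableSpace M]
  {κ : Kernel M M} [IsMarkovKernel κ]

theorem commute_self (x : M) : commute κ x x = 0 := by
  simp [commute, expect_hitTime_self]

theorem gammaOne_le_cov (hirr : IsIrreducibleChain κ) (hpos : IsPositiveRecurrent κ)
    (hrev : IsReversibleChain κ) (A : Set M) : gammaOne κ A ≤ (24734 : ℝ≥0) * cov κ A := by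
  by_cases hA : cov κ A = ∞
  · rw [hA, ENNReal.mul_top (by norm_num)]
    exact le_top
  have hfin := expect_hitTime_ne_top hirr hpos
  set F : Set A → ℝ := fun B => (cov κ (Subtype.val '' B)).toReal with hF
  have hBA : ∀ B : Set A, cov κ (Subtype.val '' B) ≠ ∞ := fun B =>
    ne_top_of_le_ne_top hA (cov_mono κ (Subtype.coe_image_subset A B))
  have hmono : ∀ B C : Set A, B ⊆ C → F B ≤ F C := fun B C h =>
    ENNReal.toReal_mono (hBA C) (cov_mono κ (Set.image_mono h))
  have hgrow : GrowthCondition (fun x y : A => commuteReal κ x y) F := by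
    intro n hn a β ha t H ht hsep hball hβ
    refine cov_growth hirr hpos hrev (hBA _) hn ha (fun l => (t l : M))
      (fun l => Subtype.val '' H l) (fun l => ⟨t l, ht l, rfl⟩) ?_ hsep ?_ hβ
    · exact fun l => Set.image_mono (Set.subset_iUnion H l)
    · rintro l _ ⟨y, hy, rfl⟩
      exact hball l y hy
  have hFuniv : F Set.univ = (cov κ A).toReal := by
    simp only [hF, Set.image_univ, Subtype.range_coe]
  have hdist : ∀ x y : A, commuteReal κ x y ≤ 2 * (cov κ A).toReal := by
    intro x y
    have h1 := ENNReal.toReal_mono hA (expect_hitTime_le_cov κ x.2 y.2)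
    have h2 := ENNReal.toReal_mono hA (expect_hitTime_le_cov κ y.2 x.2)
    unfold commuteReal hitReal
    linarith
  -- The scheme needs a strictly positive initial radius, while cov may vanish; hence r = 2·cov +
  -- ε/79. The constant is 24576 + 79·2 = 24734.
  refine ENNReal.le_of_forall_pos_le_add fun ε hε _ => ?_
  have hε' : (0 : ℝ) < ε := hε
  have hc0 : 0 ≤ (cov κ A).toReal := ENNReal.toReal_nonneg
  obtain ⟨𝒜, D, h𝒜, hD, hD0, hK⟩ := exists_admissible
    (d := fun x y : A => commuteReal κ x y) (fun x y => commuteReal_comm κ x y)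
    (fun x => by simp [commuteReal, hitReal_self]) (fun x y z => commuteReal_triangle hfin x y z)
    (fun _ => ENNReal.toReal_nonneg) hmono hgrow (r := 2 * (cov κ A).toReal + ε / 79)
    (by positivity) (fun x y => (hdist x y).trans (le_add_of_nonneg_right (by positivity)))
  have key := chainingFunctional_one_le h𝒜 hD hD0 hK
  have hγ : gammaOne κ A =
      chainingFunctional 1 A (fun x y => ENNReal.ofReal (commuteReal κ x y)) := by
    unfold gammaOne
    congr 1
    ext x y
    exact commute_eq_ofReal hfin x y
  rw [hγ]
  refine key.trans (le_of_eq ?_)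
  have hval : 24576 * F Set.univ + 79 * (2 * (cov κ A).toReal + ε / 79) =
      24734 * (cov κ A).toReal + ε := by
    rw [hFuniv]; ring
  rw [hval, ENNReal.ofReal_add (by positivity) hε'.le, ENNReal.ofReal_mul (by norm_num),
    ENNReal.ofReal_toReal hA, ENNReal.ofReal_coe_nnreal]
  simp

theorem sq_gammaTwoSqrt_le {A : Set M} (hA : A.Finite) (hcard : 3 ≤ A.ncard) :
    gammaTwoSqrt κ A ^ 2 ≤ (Real.toNNReal (2 + 2 / Real.log (Real.log 3)) : ℝ≥0∞) *
      ENNReal.ofReal (Real.log (Real.log A.ncard)) * gammaOne κ A := by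
  obtain ⟨k, hk1, hk2, hk3⟩ := exists_scale_le_log_log hcard
  have := hA.fintype
  have hAcard : Fintype.card A = A.ncard := by
    rw [Set.ncard_eq_toFinset_card', Set.toFinset_card]
  refine (sq_chainingFunctional_two_le (S := A) (fun x y => commute κ x y)
    (fun x => commute_self x.1) hk1 (hAcard ▸ hk2)).trans (mul_le_mul' ?_ le_rfl)
  have hc := log_log_three_pos
  change _ ≤ ENNReal.ofReal _ * _
  rw [← ENNReal.ofReal_mul (by positivity), ← ENNReal.ofReal_natCast]
  exact ENNReal.ofReal_le_ofReal hk3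

end Main

end CoverTime

end

theorem mainTheorem2 :
    ∃ L C : ℝ≥0, ∀ (M : Type*) [Countable M] [MeasurableSpace M] [DiscreteMeasurableSpace M]
      (κ : Kernel M M) [IsMarkovKernel κ],
      CoverTime.IsIrreducibleChain κ → CoverTime.IsPositiveRecurrent κ →
      CoverTime.IsReversibleChain κ →
        (∀ A : Set M, CoverTime.gammaOne κ A ≤ L * CoverTime.cov κ A) ∧
        (∀ A : Set M, A.Finite → 3 ≤ A.ncard →
          CoverTime.gammaOne κ A ≤ CoverTime.gammaTwoSqrt κ A ^ 2 ∧
          CoverTime.gammaTwoSqrt κ A ^ 2 ≤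
            C * ENNReal.ofReal (Real.log (Real.log A.ncard)) * CoverTime.gammaOne κ A) := by
  refine ⟨24734, Real.toNNReal (2 + 2 / Real.log (Real.log 3)), ?_⟩
  intro M _ _ _ κ _ hirr hpos hrev
  exact ⟨CoverTime.gammaOne_le_cov hirr hpos hrev, fun A hA hcard =>
    ⟨CoverTime.chainingFunctional_one_le_sq _, CoverTime.sq_gammaTwoSqrt_le hA hcard⟩⟩
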